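/- **Setting.** Let $\mathbb D^2=\{z\in\mathbb C^2:|z_1|,|z_2|<1\}$ and $\mathbb T^2=\{z\in\mathbb C^2:|z_1|=|z_2|=1\}$. Let $S:\mathbb D^2\to\mathbb C^{M\times N}$ be rational and iso-inner, i.e. $S$ is rational with no poles in $\mathbb D^2$ and $S^*S=I_N$ on $\mathbb T^2$ away from the zero set of its denominator. Write $S=Q/p$ in lowest terms, where $p\in\mathbb C[z_1,z_2]$ has no zeros in $\mathbb D^2$, $Q\in\mathbb C^{M\times N}[z_1,z_2]$, and $p$ and the entries of $Q$ have no common non-unit factor. Let $n$ be the maximum of the degrees in $z_1$ of $p$ and of the entries of $Q$, write $p(z)=\sum_{j=0}^n p_j(z_2)z_1^j$, $Q(z)=\sum_{j=0}^n Q_j(z_2)z_1^j$, and put $\Lambda(z_1)=(I_N,z_1I_N,\dots,z_1^{n-1}I_N)^t$. **The construction of $G$ and $H$.** 1. Choose an $r\times nN$ matrix polynomial $A(z_2)$ such that for all $\zeta$ with $|\zeta|=1$ and all $w_1,z_1\in\mathbb C$ $$\overline{p(w_1,\zeta)}\,p(z_1,\zeta)I_N-Q(w_1,\zeta)^*Q(z_1,\zeta)=(1-\bar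 w_1z_1)\,\Lambda(w_1)^*A(\zeta)^*A(\zeta)\Lambda(z_1),$$ and such that $A$ has a rational right inverse $B$ analytic in the unit disk $\mathbb D$ (so $AB=I_r$). Put $G(z)=A(z_2)\Lambda(z_1)$. 2. On $\mathbb D$ let $$U=\begin{pmatrix}(Q_0,\dots,Q_n)\\(A,\,0_{r\times N})\end{pmatrix}\begin{pmatrix}p_0^{-1}I_N&X\\0&B\end{pmatrix},\qquad X=-p_0^{-1}(p_1I_N,\dots,p_nI_N)B,$$ the matrix product of an $(M+r)\times(n+1)N$ and an $(n+1)N\times(N+r)$ matrix. 3. Choose a constant isometric matrix $V$ and a matrix function $F$ on $\mathbb D$ such that $$V\begin{pmatrix}I\\ z_2F(z_2)\end{pmatrix}=\begin{pmatrix}U(z_2)\\F(z_2)\end{pmatrix}\qquad(z_2\in\mathbb D),$$ and let $H$ be the matrix polynomial with $H(z)=F(z_2)\begin{pmatrix}p(z)I_N\\z_1G(z)\end{pmatrix}$ for $z\in\mathbb D^2$. The kernel $G(w)^*G(z)$ is called the dominant $z_1$-term and $H(w)^*H(z)$ the sub-dominant $z_2$-term of $S$. **Proposition.** The construction can be carried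 out. Let $G,H$ be the result of it, for any of the possible choices. Then $$\overline{p(w)}p(z)I-Q(w)^*Q(z)=(1-\bar w_1z_1)G(w)^*G(z)+(1-\bar w_2z_2)H(w)^*H(z)\qquad(w,z\in\mathbb C^2).$$ Moreover, if $\Gamma_1,\Gamma_2$ are any matrix polynomials in $z_1,z_2$ (with $N$ columns) such that $$\overline{p(w)}p(z)I-Q(w)^*Q(z)=(1-\bar w_1z_1)\Gamma_1(w)^*\Gamma_1(z)+(1-\bar w_2z_2)\Gamma_2(w)^*\Gamma_2(z)\qquad(w,z\in\mathbb C^2),$$ then $$(w,z)\mapsto\frac{G(w)^*G(z)-\Gamma_1(w)^*\Gamma_1(z)}{1-\bar w_2z_2}=\frac{\Gamma_2(w)^*\Gamma_2(z)-H(w)^*H(z)}{1-\bar w_1z_1}$$ is a positive semi-definite polynomial kernel: there is an $N\times N$ matrix $K(w,z)$ of polynomials in $\bar w_1,\bar w_2,z_1,z_2$ with $(1-\bar w_2z_2)K=G^*G-\Gamma_1^*\Gamma_1$ and $(1-\bar w_1z_1)K=\Gamma_2^*\Gamma_2-H^*H$ on $\mathbb C^2\times\mathbb C^2$, and $\sum_{i,j}\langle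 K(x_i,x_j)v_j,v_i\rangle\ge0$ for all finitely many $x_1,\dots,x_m\in\mathbb C^2$ and $v_1,\dots,v_m\in\mathbb C^N$. -/

import Mathlib

open Polynomial Matrix
open scoped ComplexConjugate ComplexOrder

noncomputable section

namespace Bidisk

/-- Polynomials in `(z₁, z₂)`, written as polynomials in the (outer) variable `z₁` whose
coefficients are polynomials in the (inner) variable `z₂`. -/
abbrev BiPoly : Type := Polynomial (Polynomial ℂ)

/-- The value `f(z₁, z₂)` at `z = (z₁, z₂)`. -/
def ev (f : BiPoly) (z : ℂ × ℂ) : ℂ := f.evalEval z.2 z.1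

/-- The value of a matrix polynomial in two variables. -/
def evM {m n : Type*} (Γ : Matrix m n BiPoly) (z : ℂ × ℂ) : Matrix m n ℂ :=
  Γ.map fun f => ev f z

/-- The value of a matrix polynomial in one variable. -/
def ev₁ {m n : Type*} (A : Matrix m n ℂ[X]) (ζ : ℂ) : Matrix m n ℂ :=
  A.map fun f => f.eval ζ

/-- The open unit bidisk. -/
def bidisk : Set (ℂ × ℂ) := {z | ‖z.1‖ < 1 ∧ ‖z.2‖ < 1}

/-- The two-torus. -/
def torus : Set (ℂ × ℂ) := {z | ‖z.1‖ = 1 ∧ ‖z.2‖ = 1}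

/-- `S = Q / p` in lowest terms on the bidisk: `p` has no zeros in the bidisk (so `S` has no poles
there), and the only common divisors of `p` and of all the entries of `Q` are the units. -/
structure IsLowestTerms {M N : ℕ} (S : ℂ × ℂ → Matrix (Fin M) (Fin N) ℂ)
    (p : BiPoly) (Q : Matrix (Fin M) (Fin N) BiPoly) : Prop where
  ne_zero : ∀ z ∈ bidisk, ev p z ≠ 0
  eq_div : ∀ z ∈ bidisk, S z = (ev p z)⁻¹ • evM Q z
  no_common_factor : ∀ d : BiPoly, d ∣ p → (∀ i j, d ∣ Q i j) → IsUnit d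

/-- Rational iso-inner functions on the bidisk: rational, without poles in the bidisk, and
`S* S = I` on the two-torus away from the zero set of the denominator. -/
def IsRationalIsoInner {M N : ℕ} (S : ℂ × ℂ → Matrix (Fin M) (Fin N) ℂ) : Prop :=
  ∃ (p : BiPoly) (Q : Matrix (Fin M) (Fin N) BiPoly), IsLowestTerms S p Q ∧
    ∀ z ∈ torus, ev p z ≠ 0 →
      ((ev p z)⁻¹ • evM Q z)ᴴ * ((ev p z)⁻¹ • evM Q z) = 1

/-- The kernel `(w, z) ↦ Γ(w)* Γ(z)`. -/
def gram {k N : ℕ} (Γ : Matrix (Fin k) (Fin N) BiPoly) (w z : ℂ × ℂ) :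
    Matrix (Fin N) (Fin N) ℂ :=
  (evM Γ w)ᴴ * evM Γ z

/-- The kernel `(w, z) ↦ conj (p(w)) p(z) I - Q(w)* Q(z)`. -/
def defect {M N : ℕ} (p : BiPoly) (Q : Matrix (Fin M) (Fin N) BiPoly) (w z : ℂ × ℂ) :
    Matrix (Fin N) (Fin N) ℂ :=
  (conj (ev p w) * ev p z) • (1 : Matrix (Fin N) (Fin N) ℂ) - (evM Q w)ᴴ * evM Q z

/-- The decomposition `p̄ p I - Q* Q = (1 - w̄₁ z₁) Γ₁* Γ₁ + (1 - w̄₂ z₂) Γ₂* Γ₂`. -/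
def IsDecomposition {M N k l : ℕ} (p : BiPoly) (Q : Matrix (Fin M) (Fin N) BiPoly)
    (Γ₁ : Matrix (Fin k) (Fin N) BiPoly) (Γ₂ : Matrix (Fin l) (Fin N) BiPoly) : Prop :=
  ∀ w z : ℂ × ℂ, defect p Q w z =
    (1 - conj w.1 * z.1) • gram Γ₁ w z + (1 - conj w.2 * z.2) • gram Γ₂ w z

/-- Positive semi-definite matrix kernels (`0 ≤ c` for complex `c` means real and nonnegative). -/
def IsPSDKernel {X : Type*} {N : ℕ} (K : X → X → Matrix (Fin N) (Fin N) ℂ) : Prop :=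
  ∀ (n : ℕ) (x : Fin n → X) (v : Fin n → Fin N → ℂ),
    0 ≤ ∑ i, ∑ j, star (v i) ⬝ᵥ (K (x i) (x j) *ᵥ v j)

/-- `K(w, z)` is a matrix polynomial in `w̄₁, w̄₂, z₁, z₂`. -/
def IsPolynomialKernel {N : ℕ} (K : ℂ × ℂ → ℂ × ℂ → Matrix (Fin N) (Fin N) ℂ) : Prop :=
  ∃ P : Matrix (Fin N) (Fin N) (MvPolynomial (Fin 4) ℂ), ∀ w z : ℂ × ℂ,
    K w z = P.map fun f => MvPolynomial.eval ![conj w.1, conj w.2, z.1, z.2] f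

/-- `n₁`: the maximum of the degrees in `z₁` of `p` and of the entries of `Q`. -/
def degZ₁ {M N : ℕ} (p : BiPoly) (Q : Matrix (Fin M) (Fin N) BiPoly) : ℕ :=
  max p.natDegree (Finset.univ.sup fun i => Finset.univ.sup fun j => (Q i j).natDegree)

/-- The block column `Λ(z₁) = (I, z₁ I, …, z₁ⁿ⁻¹ I)ᵗ`; the index `(k, i)` is row `i` of block
`k`. -/
def lam (n N : ℕ) (z₁ : ℂ) : Matrix (Fin n × Fin N) (Fin N) ℂ :=
  Matrix.of fun x j => if x.2 = j then z₁ ^ (x.1 : ℕ) else 0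

/-- The matrix polynomial `A(z₂) Λ(z₁)`. -/
def timesLam {r n N : ℕ} (A : Matrix (Fin r) (Fin n × Fin N) ℂ[X]) :
    Matrix (Fin r) (Fin N) BiPoly :=
  Matrix.of fun a j => ∑ k : Fin n, Polynomial.C (A a (k, j)) * Polynomial.X ^ (k : ℕ)

/-- The block matrix with first block row `(Q₀, …, Qₙ)` and second block row `(A, 0)`, at
`z₂ = ζ`, where `Q(z) = ∑ⱼ Qⱼ(z₂) z₁ʲ`. -/
def targetMatrix {M N n r : ℕ} (Q : Matrix (Fin M) (Fin N) BiPoly)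
    (A : Matrix (Fin r) (Fin n × Fin N) ℂ[X]) (ζ : ℂ) :
    Matrix (Fin M ⊕ Fin r) (Fin (n + 1) × Fin N) ℂ :=
  Matrix.fromRows
    (Matrix.of fun i x => ((Q i x.2).coeff (x.1 : ℕ)).eval ζ)
    (Matrix.of fun a x =>
      Fin.lastCases (motive := fun _ => ℂ) 0 (fun k => (A a (k, x.2)).eval ζ) x.1)

/-- The block matrix with block rows `(p₀⁻¹ I, X)` and `(0, B)`, at `z₂ = ζ`, where
`p(z) = ∑ⱼ pⱼ(z₂) z₁ʲ` and `X = -p₀⁻¹ (p₁ I, …, pₙ I) B`. If `A B = I` it is a right inverse of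
the matrix with block rows `(p₀ I, …, pₙ I)` and `(0, A)`. -/
def rightInverse {N n r : ℕ} (p : BiPoly) (B : ℂ → Matrix (Fin n × Fin N) (Fin r) ℂ) (ζ : ℂ) :
    Matrix (Fin (n + 1) × Fin N) (Fin N ⊕ Fin r) ℂ :=
  Matrix.fromCols
    (Matrix.of fun x j => if x.1 = 0 ∧ x.2 = j then ((p.coeff 0).eval ζ)⁻¹ else 0)
    (Matrix.of fun x a =>
      Fin.cases (motive := fun _ => ℂ)
        (-((p.coeff 0).eval ζ)⁻¹ * ∑ k : Fin n, (p.coeff ((k : ℕ) + 1)).eval ζ * B ζ (k, x.2) a)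
        (fun k => B ζ (k, x.2) a) x.1)

/-- A run of Kummert's construction for `S = Q / p`, with the choices made in it. -/
structure KummertConstruction {M N : ℕ} (p : BiPoly) (Q : Matrix (Fin M) (Fin N) BiPoly) where
  /-- the number of rows of the spectral factor `A` -/
  r : ℕ
  /-- the spectral factor, a matrix polynomial in `z₂` -/
  A : Matrix (Fin r) (Fin (degZ₁ p Q) × Fin N) ℂ[X]
  /-- `A* A` is, for `|z₂| = 1`, the coefficient matrix of
  `(p̄ p I - Q* Q) / (1 - w̄₁ z₁)` at `w₂ = z₂` -/
  factor : ∀ ζ : ℂ, ‖ζ‖ = 1 → ∀ w₁ z₁ : ℂ, defect p Q (w₁, ζ) (z₁, ζ) =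
    (1 - conj w₁ * z₁) •
      ((lam (degZ₁ p Q) N w₁)ᴴ * ((ev₁ A ζ)ᴴ * ev₁ A ζ) * lam (degZ₁ p Q) N z₁)
  /-- the denominator and the numerator of the right inverse `B = B' / b` of `A` -/
  b : ℂ[X]
  B' : Matrix (Fin (degZ₁ p Q) × Fin N) (Fin r) ℂ[X]
  /-- `B` is a rational right inverse of `A` that is analytic in the disk -/
  b_ne_zero : ∀ ζ : ℂ, ‖ζ‖ < 1 → b.eval ζ ≠ 0
  A_mul_B : ∀ ζ : ℂ, ‖ζ‖ < 1 → ev₁ A ζ * ((b.eval ζ)⁻¹ • ev₁ B' ζ) = 1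
  /-- the size of the realization of the one variable iso-inner function
  `U = targetMatrix * rightInverse` by the constant isometric matrix `V` and the matrix function
  `F`, both as functions on the disk -/
  s : ℕ
  V : Matrix ((Fin M ⊕ Fin r) ⊕ Fin s) ((Fin N ⊕ Fin r) ⊕ Fin s) ℂ
  F : ℂ → Matrix (Fin s) (Fin N ⊕ Fin r) ℂ
  isometric : Vᴴ * V = 1
  realization : ∀ ζ : ℂ, ‖ζ‖ < 1 →
    V * Matrix.fromRows 1 (ζ • F ζ) =
      Matrix.fromRows
        (targetMatrix Q A ζ * rightInverse p (fun ζ => (b.eval ζ)⁻¹ • ev₁ B' ζ) ζ) (F ζ)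
  /-- the matrix polynomial `H(z) = F(z₂) (p(z) I, z₁ G(z))ᵗ`, where `G(z) = A(z₂) Λ(z₁)` -/
  H : Matrix (Fin s) (Fin N) BiPoly
  H_eq : ∀ z ∈ bidisk, evM H z =
    F z.2 * Matrix.fromRows (ev p z • (1 : Matrix (Fin N) (Fin N) ℂ))
      (z.1 • evM (timesLam A) z)

/-- `G(z) = A(z₂) Λ(z₁)`. The kernel `gram 𝒦.G` is the dominant `z₁`-term, and `gram 𝒦.H` is the
sub-dominant `z₂`-term. -/
def KummertConstruction.G {M N : ℕ} {p : BiPoly} {Q : Matrix (Fin M) (Fin N) BiPoly}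
    (𝒦 : KummertConstruction p Q) : Matrix (Fin 𝒦.r) (Fin N) BiPoly :=
  timesLam 𝒦.A

end Bidisk

end

/-! Everything rests on one fact about matrix polynomials in one variable. Suppose `A* A = C* C` on
the unit circle and `A(ζ)` has a right inverse at each `ζ` in the disk. Then `(A(w)* A(z) - C(w)*
C(z)) / (1 - w̄ z)` equals `L(w)* L(z)` for a matrix polynomial `L` (`exists_gram_of_isometric`).
The coefficient matrix of the quotient is the Bezoutian `T_A* T_A - T_C* T_C` of triangular block
Toeplitz matrices. It is positive because `A` is outer. Adding a multiple of `z^d` to `f` does not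
change the part of `C f` of degree less than `d`, while a suitable multiple makes the tail of `A f`
as small as desired. Hence the low order part of `C f` has norm at most that of the low order part
of `A f` (`sum_tsq_le`).

This fact is used three times.

Existence of `A`: for `|ζ| = 1`, apply it to `p(·, ζ) I` and `Q(·, ζ)`. By Hurwitz, `p(·, ζ)` has no
zeros in the disk or vanishes identically (and then so does `Q(·, ζ)`), so the coefficient matrix of
the `z₁`-quotient of the defect is positive semi-definite on the circle. The matrix Fejér-Riesz
theorem (`exists_outer_factor`) factors it with an outer polynomial `A`. That theorem is obtained
from the Wold decomposition of the shift on the completion of the polynomial vectors.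

Existence of `H`: let `T` and `T'` be the coefficient matrices of `(p I, z₁ G)` and `(Q, G)` in
powers of `z₁`. The defining identity of `A` says `T* T = T'* T'` on the circle, and `T` has a right
inverse `R` in the disk. So `T(w)* T(z) - T'(w)* T'(z) = (1 - w̄ z) L(w)* L(z)`. Then `U = T' R` and
`F = L R` satisfy the Gram identity from which a constant isometry `V` is obtained. Positivity on
the diagonal gives `U T = T'` and `F T = L`, so `H = L Λ` is a polynomial. For every choice of `V`
and `F` the isometry takes `(p I, z₁ G, z₂ H)` to `(Q, G, H)`; comparing Gram matrices gives the
decomposition.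

Dominance: at `w₂ = z₂` on the circle the second term of any decomposition vanishes. A degree count
then gives `Γ₁ = C(z₂) Λ(z₁)`, and `C* C = A* A` on the circle. The fact applied to `A` and `C`
gives `K` as a Gram kernel. The formula with `H` and `Γ₂` follows by subtracting the two
decompositions. -/

noncomputable section

/-! ### Coefficient norms and cyclic polynomials for the shift -/

namespace Bidisk

/-- The sum of the squares of the absolute values of the coefficients. -/
def nsq (f : ℂ[X]) : ℝ := ∑ k ∈ f.support, ‖f.coeff k‖ ^ 2

/-- The part of `nsq f` that comes from the coefficients of degree less than `d`. -/
def tsq (d : ℕ) (f : ℂ[X]) : ℝ := ∑ k ∈ Finset.range d, ‖f.coeff k‖ ^ 2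

theorem nsq_eq_tsq {f : ℂ[X]} {d : ℕ} (h : f.natDegree < d) : nsq f = tsq d f := by
  refine Finset.sum_subset (fun k hk => ?_) fun k _ hk => ?_
  · exact Finset.mem_range.2 ((le_natDegree_of_mem_supp k hk).trans_lt h)
  · simp [notMem_support_iff.1 hk]

theorem nsq_nonneg (f : ℂ[X]) : 0 ≤ nsq f := Finset.sum_nonneg fun _ _ => by positivity

theorem tsq_le_nsq (d : ℕ) (f : ℂ[X]) : tsq d f ≤ nsq f := by
  rw [nsq_eq_tsq (d := max d (f.natDegree + 1)) (by simp)]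
  exact Finset.sum_le_sum_of_subset_of_nonneg (Finset.range_subset_range.2 (le_max_left _ _))
    fun _ _ _ => by positivity

theorem nsq_add_le (f g : ℂ[X]) : nsq (f + g) ≤ 2 * nsq f + 2 * nsq g := by
  set d := max (f.natDegree + 1) (g.natDegree + 1)
  have h : (f + g).natDegree < d := by
    have := natDegree_add_le f g
    grind
  rw [nsq_eq_tsq h, nsq_eq_tsq (f := f) (d := d) (by grind),
    nsq_eq_tsq (f := g) (d := d) (by grind)]
  simp only [tsq, Finset.mul_sum, ← Finset.sum_add_distrib]
  refine Finset.sum_le_sum fun k _ => ?_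
  have := norm_add_le (f.coeff k) (g.coeff k)
  rw [coeff_add]
  nlinarith [sq_nonneg (‖f.coeff k‖ - ‖g.coeff k‖), norm_nonneg (f.coeff k + g.coeff k)]

theorem nsq_C_mul (c : ℂ) (f : ℂ[X]) : nsq (C c * f) = ‖c‖ ^ 2 * nsq f := by
  rw [nsq_eq_tsq (d := f.natDegree + 1) (Nat.lt_succ_of_le (natDegree_C_mul_le c f)),
    nsq_eq_tsq (Nat.lt_succ_self _), tsq, tsq, Finset.mul_sum]
  simp [mul_pow]

theorem nsq_X_mul (f : ℂ[X]) : nsq (X * f) = nsq f := by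
  rw [nsq_eq_tsq (d := f.natDegree + 2) (by have := natDegree_mul_le (p := X) (q := f); simp at this; omega),
    nsq_eq_tsq (Nat.lt_succ_self _), tsq, tsq, Finset.sum_range_succ']
  simp [coeff_X_mul]

theorem nsq_X_pow_mul (n : ℕ) (f : ℂ[X]) : nsq (X ^ n * f) = nsq f := by
  induction n with
  | zero => simp
  | succ n ih => rw [pow_succ', mul_assoc, nsq_X_mul, ih]

/-- `nsq f` splits into the low order part and the rest. -/
theorem nsq_add_X_pow_mul {d : ℕ} {g : ℂ[X]} (hg : ∀ k, d ≤ k → g.coeff k = 0) (t : ℂ[X]) :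
    nsq (g + X ^ d * t) = tsq d g + nsq t := by
  have h1 : (g + X ^ d * t).natDegree < d + (t.natDegree + 1) := by
    refine Nat.lt_succ_of_le ((natDegree_add_le _ _).trans (max_le ?_ ?_))
    · exact natDegree_le_iff_coeff_eq_zero.2 fun k hk => hg k (by simp at hk; omega)
    · exact natDegree_mul_le.trans (by simp)
  rw [nsq_eq_tsq h1, nsq_eq_tsq (Nat.lt_succ_self _), tsq, tsq, tsq, Finset.sum_range_add]
  congr 1
  · refine Finset.sum_congr rfl fun k hk => ?_
    have := Finset.mem_range.1 hk
    rw [coeff_add, coeff_X_pow_mul', if_neg (by omega), add_zero]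
  · refine Finset.sum_congr rfl fun k hk => ?_
    rw [coeff_add, hg _ (by omega), zero_add, add_comm d k, coeff_X_pow_mul]

theorem exists_eq_add_X_pow_mul (d : ℕ) (f : ℂ[X]) :
    ∃ g t : ℂ[X], (∀ k, d ≤ k → g.coeff k = 0) ∧ f = g + X ^ d * t := by
  induction d with
  | zero => exact ⟨0, f, by simp, by simp⟩
  | succ d ih =>
    obtain ⟨g, t, hg, rfl⟩ := ih
    refine ⟨g + X ^ d * C (t.coeff 0), t.divX, fun k hk => ?_, ?_⟩
    · rw [coeff_add, hg k (by omega), coeff_X_pow_mul', coeff_C]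
      grind
    · conv_lhs => rw [← divX_mul_X_add t]
      ring

theorem tsq_add_X_pow_mul (d : ℕ) (f t : ℂ[X]) : tsq d (f + X ^ d * t) = tsq d f := by
  refine Finset.sum_congr rfl fun k hk => ?_
  have := Finset.mem_range.1 hk
  rw [coeff_add, coeff_X_pow_mul', if_neg (by omega), add_zero]

theorem circleIntegrable_normSq (f : ℂ[X]) :
    CircleIntegrable (fun z => ‖f.eval z‖ ^ 2) 0 1 := by
  refine ContinuousOn.circleIntegrable (by norm_num) ?_
  fun_prop

/-- Comparison of the coefficients of polynomial vectors that can be compared on the circle. -/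
theorem sum_nsq_le {a c : Type*} [Fintype a] [Fintype c] (f : a → ℂ[X]) (g : c → ℂ[X])
    (h : ∀ ζ : ℂ, ‖ζ‖ = 1 → ∑ i, ‖(f i).eval ζ‖ ^ 2 ≤ ∑ i, ‖(g i).eval ζ‖ ^ 2) :
    ∑ i, nsq (f i) ≤ ∑ i, nsq (g i) := by
  simp only [nsq, sum_sq_norm_coeff_eq_circleAverage]
  rw [← Real.circleAverage_fun_sum fun i _ => circleIntegrable_normSq (f i),
    ← Real.circleAverage_fun_sum fun i _ => circleIntegrable_normSq (g i)]
  refine Real.circleAverage_mono ?_ ?_ fun ζ hζ => h ζ (by simpa using hζ)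
  · exact CircleIntegrable.fun_sum _ fun i _ => circleIntegrable_normSq (f i)
  · exact CircleIntegrable.fun_sum _ fun i _ => circleIntegrable_normSq (g i)

/-- The polynomial multiples of `b` are dense for the norm `nsq`. -/
def IsCyclic (b : ℂ[X]) : Prop := ∀ (u : ℂ[X]) (ε : ℝ), 0 < ε → ∃ h : ℂ[X], nsq (u - b * h) < ε

/-- Multiplication by `X` preserves `nsq`, so approximating `1` by multiples of `b` approximates
every monomial, hence every polynomial. -/
theorem isCyclic_of_one {b : ℂ[X]} (hb : ∀ ε : ℝ, 0 < ε → ∃ h : ℂ[X], nsq (1 - b * h) < ε) :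
    IsCyclic b := by
  intro u
  induction u using Polynomial.induction_on' with
  | add u v hu hv =>
    intro ε hε
    obtain ⟨h, hh⟩ := hu (ε / 4) (by positivity)
    obtain ⟨k, hk⟩ := hv (ε / 4) (by positivity)
    refine ⟨h + k, ?_⟩
    have := nsq_add_le (u - b * h) (v - b * k)
    rw [show u + v - b * (h + k) = u - b * h + (v - b * k) by ring]
    linarith
  | monomial n c =>
    intro ε hε
    obtain ⟨h, hh⟩ := hb (ε / (‖c‖ ^ 2 + 1)) (by positivity)
    refine ⟨C c * (X ^ n * h), ?_⟩
    rw [← C_mul_X_pow_eq_monomial,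
      show C c * X ^ n - b * (C c * (X ^ n * h)) = C c * (X ^ n * (1 - b * h)) by ring,
      nsq_C_mul, nsq_X_pow_mul]
    rw [lt_div_iff₀ (by positivity)] at hh
    nlinarith [nsq_nonneg (1 - b * h)]

/-- Since `‖c‖ = 1` is allowed, the geometric series for the inverse need not converge. Its Cesàro
means `s` still work: the error `1 - (1 - c X) s` has `m` coefficients of modulus at most `1 / m`,
so its squared norm is at most `1 / m`. -/
theorem isCyclic_one_sub (c : ℂ) (hc : ‖c‖ ≤ 1) : IsCyclic (1 - C c * X) := by
  refine isCyclic_of_one fun ε hε => ?_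
  obtain ⟨m, hm⟩ := exists_nat_gt (1 / ε)
  have hm0 : (0 : ℝ) < m := lt_trans (by positivity) hm
  have hmc : (m : ℂ) ≠ 0 := by exact_mod_cast hm0.ne'
  let s : ℂ[X] := ∑ k ∈ Finset.range m, C (c ^ k * (1 - k / m)) * X ^ k
  let e : ℂ[X] := ∑ k ∈ Finset.range m, C (c ^ (k + 1) / m) * X ^ k
  have key : ∀ l : ℕ, l ≤ m → (1 - C c * X) * ∑ k ∈ Finset.range l, C (c ^ k * (1 - k / m)) * X ^ k
      = 1 - (∑ k ∈ Finset.range l, C (c ^ (k + 1) / m) * X ^ (k + 1))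
        - C (c ^ l * (1 - l / m)) * X ^ l := by
    intro l
    induction l with
    | zero => simp
    | succ l ih =>
      intro hl
      rw [Finset.sum_range_succ, mul_add, ih (by omega), Finset.sum_range_succ]
      simp only [C_mul, C_pow, C_sub, C_1, div_eq_mul_inv, Nat.cast_add, Nat.cast_one, C_add]
      ring
  have h1 : 1 - (1 - C c * X) * s = X * e := by
    rw [key m le_rfl]
    simp only [e, Finset.mul_sum, div_self hmc, sub_self, mul_zero, C_0, zero_mul, sub_zero,
      sub_sub_cancel]
    exact Finset.sum_congr rfl fun k _ => by ring
  refine ⟨s, ?_⟩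
  have he : ∀ k, e.coeff k = if k < m then c ^ (k + 1) / m else 0 := by
    intro k
    simp [e, finsetSum_coeff, coeff_X_pow]
  have hm1 : 0 < m := by exact_mod_cast hm0
  have hd : e.natDegree < m := by
    have : e.natDegree ≤ m - 1 :=
      natDegree_le_iff_coeff_eq_zero.2 fun k hk => by rw [he, if_neg (by omega)]
    omega
  rw [h1, nsq_X_mul, nsq_eq_tsq hd, tsq]
  calc ∑ k ∈ Finset.range m, ‖e.coeff k‖ ^ 2
      ≤ ∑ k ∈ Finset.range m, (1 / m : ℝ) ^ 2 := by
        refine Finset.sum_le_sum fun k hk => ?_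
        rw [he, if_pos (Finset.mem_range.1 hk), norm_div, norm_pow, Complex.norm_natCast]
        gcongr
        exact pow_le_one₀ (norm_nonneg _) hc
    _ = 1 / m := by
        rw [Finset.sum_const, Finset.card_range, nsmul_eq_mul]
        field_simp
    _ < ε := by
        rw [div_lt_iff₀ hε] at hm
        rw [div_lt_iff₀ hm0]
        linarith

theorem nsq_mul_le (q : ℂ[X]) : ∃ c : ℝ, 0 < c ∧ ∀ f, nsq (q * f) ≤ c * nsq f := by
  induction q using Polynomial.induction_on' with
  | add p q hp hq =>
    obtain ⟨c, hc, h⟩ := hp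
    obtain ⟨d, hd, k⟩ := hq
    refine ⟨2 * c + 2 * d, by positivity, fun f => ?_⟩
    have := nsq_add_le (p * f) (q * f)
    rw [add_mul]
    linarith [h f, k f]
  | monomial n c =>
    refine ⟨‖c‖ ^ 2 + 1, by positivity, fun f => ?_⟩
    rw [← C_mul_X_pow_eq_monomial, mul_assoc, nsq_C_mul, nsq_X_pow_mul]
    nlinarith [nsq_nonneg f]

theorem IsCyclic.mul {p q : ℂ[X]} (hp : IsCyclic p) (hq : IsCyclic q) : IsCyclic (p * q) := by
  intro u ε hε
  obtain ⟨c, hc, hcp⟩ := nsq_mul_le p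
  obtain ⟨h, hh⟩ := hp u (ε / 4) (by positivity)
  obtain ⟨k, hk⟩ := hq h (ε / (4 * c)) (by positivity)
  refine ⟨k, ?_⟩
  rw [show u - p * q * k = (u - p * h) + p * (h - q * k) by ring]
  rw [lt_div_iff₀ (by positivity)] at hk
  linarith [nsq_add_le (u - p * h) (p * (h - q * k)), hcp (h - q * k)]

theorem isCyclic_C {c : ℂ} (hc : c ≠ 0) : IsCyclic (C c) := fun u ε hε =>
  ⟨C c⁻¹ * u, by rw [← mul_assoc, ← C_mul, mul_inv_cancel₀ hc]; simpa [nsq] using hε⟩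

/-- A polynomial without zeros in the open unit disk is cyclic for the shift. -/
theorem isCyclic_of_ne_zero (b : ℂ[X]) (hb : ∀ ζ : ℂ, ‖ζ‖ < 1 → b.eval ζ ≠ 0) : IsCyclic b := by
  induction hn : b.natDegree generalizing b with
  | zero =>
    rw [eq_C_of_natDegree_eq_zero hn] at hb ⊢
    exact isCyclic_C (by simpa using hb 0 (by simp))
  | succ n ih =>
    obtain ⟨a, ha⟩ := IsAlgClosed.exists_root b (by
      intro h
      have := natDegree_eq_of_degree_eq_some (n := 0) h
      omega)
    obtain ⟨q, rfl⟩ := dvd_iff_isRoot.2 ha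
    have ha1 : 1 ≤ ‖a‖ := by
      by_contra h
      exact hb a (not_le.1 h) ha
    have ha0 : a ≠ 0 := by
      rintro rfl
      simp at ha1
      linarith
    have hq0 : q ≠ 0 := by
      rintro rfl
      simp at hn
    -- The root satisfies `‖a‖ ≥ 1`, so the linear factor is a unit times `1 - a⁻¹ X` with `‖a⁻¹‖ ≤
    -- 1`.
    have h1 : X - C a = C (-a) * (1 - C a⁻¹ * X) := by
      rw [mul_sub, ← mul_assoc, ← C_mul]
      simp [ha0]
      ring
    refine IsCyclic.mul ?_ (ih q (fun ζ hζ h => hb ζ hζ (by simp [h])) ?_)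
    · rw [h1]
      refine (isCyclic_C (neg_ne_zero.2 ha0)).mul (isCyclic_one_sub _ ?_)
      rw [norm_inv]
      exact inv_le_one_of_one_le₀ ha1
    · rw [natDegree_mul (X_sub_C_ne_zero a) hq0, natDegree_X_sub_C] at hn
      omega

end Bidisk

/-! ### Rational right inverses and the extremal property of outer factors -/

namespace Bidisk

theorem ev₁_mul {l m n : Type*} [Fintype m] (A : Matrix l m ℂ[X]) (B : Matrix m n ℂ[X]) (ζ : ℂ) :
    ev₁ (A * B) ζ = ev₁ A ζ * ev₁ B ζ :=
  Matrix.map_mul (f := Polynomial.evalRingHom ζ)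

theorem ev₁_apply {m n : Type*} (A : Matrix m n ℂ[X]) (ζ : ℂ) (i : m) (j : n) :
    ev₁ A ζ i j = (A i j).eval ζ := rfl

/-- A polynomial matrix that has a right inverse at each point of the disk has a rational right
inverse that is analytic in the disk. -/
theorem exists_rational_rightInverse {a n : Type*} [Fintype a] [DecidableEq a] [Fintype n]
    (A : Matrix a n ℂ[X]) (hA : ∀ ζ : ℂ, ‖ζ‖ < 1 → ∃ B : Matrix n a ℂ, ev₁ A ζ * B = 1) :
    ∃ (b : ℂ[X]) (B : Matrix n a ℂ[X]), (∀ ζ : ℂ, ‖ζ‖ < 1 → b.eval ζ ≠ 0) ∧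
      A * B = b • (1 : Matrix a a ℂ[X]) := by
  -- The possible denominators form an ideal, and its generator is the best candidate. A zero `ζ` of
  -- the generator in the disk would be a zero of every element. But if the constant matrix `C` is a
  -- right inverse at `ζ`, the adjugate puts `det (A C)` in the ideal, and this determinant is `1`
  -- at `ζ`.
  let I : Ideal ℂ[X] :=
    { carrier := {b | ∃ B : Matrix n a ℂ[X], A * B = b • (1 : Matrix a a ℂ[X])}
      add_mem' := by
        rintro b c ⟨B, hB⟩ ⟨C, hC⟩
        exact ⟨B + C, by rw [Matrix.mul_add, hB, hC, add_smul]⟩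
      zero_mem' := ⟨0, by simp⟩
      smul_mem' := by
        rintro c b ⟨B, hB⟩
        exact ⟨c • B, by rw [Matrix.mul_smul, hB, smul_smul, smul_eq_mul]⟩ }
  obtain ⟨b, hb⟩ := (IsPrincipalIdealRing.principal I).principal
  obtain ⟨B, hB⟩ : b ∈ I := hb ▸ Submodule.mem_span_singleton_self b
  refine ⟨b, B, fun ζ hζ h0 => ?_, hB⟩
  obtain ⟨C, hC⟩ := hA ζ hζ
  let C' : Matrix n a ℂ[X] := C.map Polynomial.C
  have hC' : ev₁ C' ζ = C := by ext; simp [ev₁, C']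
  have hd : (A * C').det ∈ I :=
    ⟨C' * (A * C').adjugate, by rw [← Matrix.mul_assoc, Matrix.mul_adjugate]⟩
  rw [hb] at hd
  obtain ⟨c, hc⟩ := Submodule.mem_span_singleton.1 hd
  have h1 : (A * C').det.eval ζ = 1 := by
    have := RingHom.map_det (Polynomial.evalRingHom ζ) (A * C')
    have h2 : (Polynomial.evalRingHom ζ).mapMatrix (A * C') = ev₁ (A * C') ζ := rfl
    rw [h2, ev₁_mul, hC', hC, det_one] at this
    exact this
  rw [← hc, smul_eq_mul, eval_mul, h0, mul_zero] at h1
  exact zero_ne_one h1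

theorem ev₁_mulVec {m n : Type*} [Fintype n] (A : Matrix m n ℂ[X]) (f : n → ℂ[X]) (ζ : ℂ) (i : m) :
    ((A *ᵥ f) i).eval ζ = (ev₁ A ζ *ᵥ fun j => (f j).eval ζ) i := by
  simp [Matrix.mulVec, dotProduct, eval_finsetSum, ev₁]

theorem sum_norm_sq_mulVec {m n : Type*} [Fintype m] [Fintype n] (A : Matrix m n ℂ) (x : n → ℂ) :
    ((∑ i, ‖(A *ᵥ x) i‖ ^ 2 : ℝ) : ℂ) = star x ⬝ᵥ ((Aᴴ * A) *ᵥ x) := by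
  rw [← Matrix.mulVec_mulVec, Matrix.dotProduct_mulVec, ← Matrix.star_mulVec]
  simp [dotProduct, Complex.conj_mul']

/-- If `A` has a right inverse at each point of the disk and `A* A = C* C` on the circle, then
the lower triangular Toeplitz matrices of `A` dominate those of `C`. -/
theorem sum_tsq_le {a c n : Type*} [Fintype a] [DecidableEq a] [Fintype c] [Fintype n]
    (A : Matrix a n ℂ[X]) (C : Matrix c n ℂ[X])
    (hAC : ∀ ζ : ℂ, ‖ζ‖ = 1 → (ev₁ A ζ)ᴴ * ev₁ A ζ = (ev₁ C ζ)ᴴ * ev₁ C ζ)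
    (hA : ∀ ζ : ℂ, ‖ζ‖ < 1 → ∃ B : Matrix n a ℂ, ev₁ A ζ * B = 1)
    (d : ℕ) (f : n → ℂ[X]) :
    ∑ i, tsq d ((C *ᵥ f) i) ≤ ∑ i, tsq d ((A *ᵥ f) i) := by
  obtain ⟨b, B, hb, hB⟩ := exists_rational_rightInverse A hA
  have hcyc := isCyclic_of_ne_zero b hb
  choose g t hg ht using fun i => exists_eq_add_X_pow_mul d ((A *ᵥ f) i)
  refine le_of_forall_pos_le_add fun ε hε => ?_
  -- The `+ 1` keeps the quotient meaningful when `A` has no rows.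
  choose s hs using fun i => hcyc (t i) (ε / (Fintype.card a + 1)) (by positivity)
  -- Since `A B = b`, this correction of `f` replaces the tail `t` of `A f` by the small `t - b s`,
  -- and it leaves the terms of `A f` and `C f` of degree less than `d` unchanged.
  let h : n → ℂ[X] := f + (X ^ d : ℂ[X]) • (-(B *ᵥ s))
  have hAh : ∀ i, (A *ᵥ h) i = g i + X ^ d * (t i - b * s i) := fun i => by
    simp only [h, Matrix.mulVec_add, Matrix.mulVec_smul, Matrix.mulVec_neg, Matrix.mulVec_mulVec, hB,
      Pi.add_apply, Pi.smul_apply, Pi.neg_apply, smul_eq_mul, ht i, Matrix.smul_mulVec,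
      Matrix.one_mulVec]
    ring
  have hCh : ∀ i, (C *ᵥ h) i = (C *ᵥ f) i + X ^ d * (-(C *ᵥ (B *ᵥ s))) i := fun i => by
    simp only [h, Matrix.mulVec_add, Matrix.mulVec_smul, Matrix.mulVec_neg,
      Pi.add_apply, Pi.smul_apply, Pi.neg_apply, smul_eq_mul]
  calc ∑ i, tsq d ((C *ᵥ f) i) = ∑ i, tsq d ((C *ᵥ h) i) := by
        simp only [hCh, tsq_add_X_pow_mul]
    _ ≤ ∑ i, nsq ((C *ᵥ h) i) := Finset.sum_le_sum fun i _ => tsq_le_nsq _ _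
    _ ≤ ∑ i, nsq ((A *ᵥ h) i) := by
        refine sum_nsq_le _ _ fun ζ hζ => le_of_eq ?_
        simp only [ev₁_mulVec]
        have := sum_norm_sq_mulVec (ev₁ A ζ) fun j => (h j).eval ζ
        rw [hAC ζ hζ, ← sum_norm_sq_mulVec] at this
        exact_mod_cast this.symm
    _ = ∑ i, tsq d ((A *ᵥ f) i) + ∑ i, nsq (t i - b * s i) := by
        rw [← Finset.sum_add_distrib]
        refine Finset.sum_congr rfl fun i _ => ?_
        rw [hAh, nsq_add_X_pow_mul (hg i), ht i, tsq_add_X_pow_mul]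
    _ ≤ ∑ i, tsq d ((A *ᵥ f) i) + ∑ _i : a, ε / (Fintype.card a + 1) := by
        gcongr with i
        exact (hs i).le
    _ ≤ ∑ i, tsq d ((A *ᵥ f) i) + ε := by
        rw [Finset.sum_const, Finset.card_univ, nsmul_eq_mul, mul_div_assoc']
        gcongr
        rw [div_le_iff₀ (by positivity)]
        nlinarith

end Bidisk

/-! ### Block Toeplitz matrices and the Bezoutian -/

namespace Bidisk

theorem infinite_circle : {ζ : ℂ | ‖ζ‖ = 1}.Infinite := by
  have h := (isPreconnected_sphere (E := ℂ) (by simp [Complex.rank_real_complex]) 0 1)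
  have h2 : (Metric.sphere (0 : ℂ) 1).Nontrivial := ⟨1, by simp, -1, by simp, by norm_num⟩
  convert h.infinite_of_nontrivial h2
  ext; simp

theorem infinite_disk : {ζ : ℂ | ‖ζ‖ < 1}.Infinite := by
  have h := (convex_ball (0 : ℂ) 1).isPreconnected
  have h2 : (Metric.ball (0 : ℂ) 1).Nontrivial := ⟨0, by simp, 1 / 2, by simp; norm_num, by norm_num⟩
  convert h.infinite_of_nontrivial h2
  ext; simp

theorem eq_of_eval_circle {p q : ℂ[X]} (h : ∀ ζ : ℂ, ‖ζ‖ = 1 → p.eval ζ = q.eval ζ) : p = q :=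
  eq_of_infinite_eval_eq _ _ (infinite_circle.mono h)

theorem eq_of_eval_disk {p q : ℂ[X]} (h : ∀ ζ : ℂ, ‖ζ‖ < 1 → p.eval ζ = q.eval ζ) : p = q :=
  eq_of_infinite_eval_eq _ _ (infinite_disk.mono h)

/-- The polynomial that agrees with `conj (a ζ) * b ζ * ζ ^ D` on the circle. -/
def crossPoly (D : ℕ) (a b : ℂ[X]) : ℂ[X] := reflect D (a.map (starRingEnd ℂ)) * b

theorem eval_crossPoly {D : ℕ} {a : ℂ[X]} (ha : a.natDegree ≤ D) (b : ℂ[X]) {ζ : ℂ}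
    (hζ : ‖ζ‖ = 1) : (crossPoly D a b).eval ζ = conj (a.eval ζ) * b.eval ζ * ζ ^ D := by
  have h0 : ζ ≠ 0 := by rintro rfl; simp at hζ
  let _ : Invertible ζ⁻¹ := invertibleOfNonzero (inv_ne_zero h0)
  have h := eval₂_reflect_mul_pow (RingHom.id ℂ) ζ⁻¹ D (a.map (starRingEnd ℂ))
    ((natDegree_map_le).trans ha)
  have h1 : conj (a.eval ζ) = (a.map (starRingEnd ℂ)).eval ζ⁻¹ := by
    rw [Complex.inv_eq_conj hζ, eval_map, eval₂_hom]
  rw [crossPoly, eval_mul, h1]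
  simp only [← eval₂_id]
  rw [← h, invOf_eq_inv, inv_inv, inv_pow]
  field_simp

theorem coeff_crossPoly (D : ℕ) (a b : ℂ[X]) {k : ℕ} (hk : k ≤ D) :
    (crossPoly D a b).coeff k =
      ∑ m ∈ Finset.range (k + 1), conj (a.coeff (D - m)) * b.coeff (k - m) := by
  rw [crossPoly, coeff_mul, Finset.Nat.sum_antidiagonal_eq_sum_range_succ_mk]
  refine Finset.sum_congr rfl fun m hm => ?_
  rw [coeff_reflect, revAt_le (by have := Finset.mem_range.1 hm; omega), coeff_map]

/-- Summation of a double sequence along the diagonals. -/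
def diagSum (E : ℕ → ℕ → ℂ) (j k : ℕ) : ℂ := ∑ m ∈ Finset.range (min j k + 1), E (j - m) (k - m)

theorem diagSum_succ (E : ℕ → ℕ → ℂ) (j k : ℕ) :
    diagSum E (j + 1) (k + 1) = E (j + 1) (k + 1) + diagSum E j k := by
  rw [diagSum, show min (j + 1) (k + 1) = min j k + 1 by omega, Finset.sum_range_succ']
  simp [diagSum, add_comm]

/-- Diagonal summation inverts multiplication by `1 - u z` on coefficients, because consecutive
diagonal sums differ by one entry of `E`. The vanishing of the last row and column of sums ensures
that multiplying by `u z` produces no term of degree `D + 1`. -/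
theorem sum_eq_mul_sum_diagSum (E : ℕ → ℕ → ℂ) (D : ℕ) (h1 : ∀ k ≤ D, diagSum E D k = 0)
    (h2 : ∀ j ≤ D, diagSum E j D = 0) (u z : ℂ) :
    ∑ j ∈ Finset.range (D + 1), ∑ k ∈ Finset.range (D + 1), E j k * (u ^ j * z ^ k) =
      (1 - u * z) * ∑ j ∈ Finset.range (D + 1), ∑ k ∈ Finset.range (D + 1),
        diagSum E j k * (u ^ j * z ^ k) := by
  have hs : u * z * ∑ j ∈ Finset.range (D + 1), ∑ k ∈ Finset.range (D + 1),
        diagSum E j k * (u ^ j * z ^ k) =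
      ∑ j ∈ Finset.range (D + 1), ∑ k ∈ Finset.range (D + 1),
        (diagSum E j k - E j k) * (u ^ j * z ^ k) := by
    rw [Finset.sum_range_succ]
    conv_rhs => rw [Finset.sum_range_succ']
    have e1 : ∑ k ∈ Finset.range (D + 1), diagSum E D k * (u ^ D * z ^ k) = 0 :=
      Finset.sum_eq_zero fun k hk => by
        rw [h1 k (by have := Finset.mem_range.1 hk; omega), zero_mul]
    have e2 : ∑ k ∈ Finset.range (D + 1), (diagSum E 0 k - E 0 k) * (u ^ 0 * z ^ k) = 0 :=
      Finset.sum_eq_zero fun k hk => by simp [diagSum]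
    rw [e1, e2, add_zero, add_zero, Finset.mul_sum]
    refine Finset.sum_congr rfl fun j hj => ?_
    rw [Finset.sum_range_succ]
    conv_rhs => rw [Finset.sum_range_succ']
    rw [h2 j (by have := Finset.mem_range.1 hj; omega)]
    simp only [diagSum_succ, add_sub_cancel_left]
    rw [show diagSum E (j + 1) 0 = E (j + 1) 0 by simp [diagSum]]
    simp only [zero_mul, add_zero, sub_self, Finset.mul_sum]
    exact Finset.sum_congr rfl fun k _ => by ring
  rw [sub_mul, one_mul, hs]
  simp only [← Finset.sum_sub_distrib]
  exact Finset.sum_congr rfl fun j _ => Finset.sum_congr rfl fun k _ => by ring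

/-- The upper triangular block Toeplitz matrix of the coefficients of a matrix polynomial. -/
def toep {R a n : Type*} [Semiring R] (d : ℕ) (A : Matrix a n R[X]) :
    Matrix (Fin d × a) (Fin d × n) R :=
  Matrix.of fun x y => if x.1 ≤ y.1 then (A x.2 y.2).coeff ((y.1 : ℕ) - x.1) else 0

/-- The block Bezoutian of two matrix polynomials. -/
def bez {a c n : Type*} [Fintype a] [Fintype c] (d : ℕ) (A : Matrix a n ℂ[X])
    (C : Matrix c n ℂ[X]) : Matrix (Fin d × n) (Fin d × n) ℂ :=
  (toep d A)ᴴ * toep d A - (toep d C)ᴴ * toep d C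

theorem toep_gram_apply {a n : Type*} [Fintype a] (d : ℕ) (A : Matrix a n ℂ[X]) (j k : Fin d)
    (i l : n) : ((toep d A)ᴴ * toep d A) (j, i) (k, l) =
      diagSum (fun j k => ∑ x, conj ((A x i).coeff j) * (A x l).coeff k) j k := by
  rw [Matrix.mul_apply, Fintype.sum_prod_type, diagSum]
  have hd : min (j : ℕ) k + 1 ≤ d := by have := j.2; omega
  have : ∀ m : Fin d, ∑ x, (toep d A)ᴴ (j, i) (m, x) * toep d A (m, x) (k, l) =
      (fun m : ℕ => if m ≤ j ∧ m ≤ k then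
        ∑ x, conj ((A x i).coeff (j - m)) * (A x l).coeff (k - m) else 0) m := by
    intro m
    by_cases h1 : m ≤ j <;> by_cases h2 : m ≤ k <;>
      simp [toep, Matrix.conjTranspose_apply, h1, h2]
  rw [Finset.sum_congr rfl fun m _ => this m,
    Fin.sum_univ_eq_sum_range (fun m : ℕ => if m ≤ j ∧ m ≤ k then
        ∑ x, conj ((A x i).coeff (j - m)) * (A x l).coeff (k - m) else 0) d]
  symm
  refine Finset.sum_subset_zero_on_sdiff (Finset.range_subset_range.2 hd) (fun m hm => ?_) fun m hm => ?_
  · simp only [Finset.mem_sdiff, Finset.mem_range] at hm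
    rw [if_neg (by omega)]
  · have := Finset.mem_range.1 hm
    rw [if_pos (by omega)]

theorem diagSum_sub (E F : ℕ → ℕ → ℂ) (j k : ℕ) :
    diagSum E j k - diagSum F j k = diagSum (fun j k => E j k - F j k) j k := by
  simp [diagSum, Finset.sum_sub_distrib]

/-- The last block row of the Bezoutian vanishes. -/
theorem bez_last {a c n : Type*} [Fintype a] [Fintype c] (D : ℕ) (A : Matrix a n ℂ[X])
    (C : Matrix c n ℂ[X]) (hA : ∀ i j, (A i j).natDegree ≤ D) (hC : ∀ i j, (C i j).natDegree ≤ D)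
    (hAC : ∀ ζ : ℂ, ‖ζ‖ = 1 → (ev₁ A ζ)ᴴ * ev₁ A ζ = (ev₁ C ζ)ᴴ * ev₁ C ζ)
    (k : Fin (D + 1)) (i l : n) : bez (D + 1) A C (Fin.last D, i) (k, l) = 0 := by
  -- The last block row of each Toeplitz Gram matrix lists coefficients of `ζ ^ D` times an entry of
  -- `A* A` or `C* C` on the circle. These polynomials agree because they agree on the circle.
  have hp : ∑ x, crossPoly D (A x i) (A x l) = ∑ x, crossPoly D (C x i) (C x l) := by
    refine eq_of_eval_circle fun ζ hζ => ?_
    have h := congrFun (congrFun (hAC ζ hζ) i) l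
    simp only [Matrix.mul_apply, Matrix.conjTranspose_apply, ev₁_apply] at h
    simp only [eval_finsetSum, eval_crossPoly (hA _ _) _ hζ, eval_crossPoly (hC _ _) _ hζ,
      ← Finset.sum_mul]
    congr 1
  have hk : (k : ℕ) ≤ D := by have := k.2; omega
  have h := congrArg (fun q => q.coeff (k : ℕ)) hp
  simp only [finsetSum_coeff, coeff_crossPoly _ _ _ hk] at h
  rw [bez, Matrix.sub_apply, toep_gram_apply, toep_gram_apply, sub_eq_zero]
  simp only [diagSum, Fin.val_last, min_eq_right hk]
  rw [Finset.sum_comm, h, Finset.sum_comm]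

theorem bez_isHermitian {a c n : Type*} [Fintype a] [Fintype c] (d : ℕ) (A : Matrix a n ℂ[X])
    (C : Matrix c n ℂ[X]) : (bez d A C).IsHermitian :=
  (isHermitian_conjTranspose_mul_self _).sub (isHermitian_conjTranspose_mul_self _)

theorem bez_last' {a c n : Type*} [Fintype a] [Fintype c] (D : ℕ) (A : Matrix a n ℂ[X])
    (C : Matrix c n ℂ[X]) (hA : ∀ i j, (A i j).natDegree ≤ D) (hC : ∀ i j, (C i j).natDegree ≤ D)
    (hAC : ∀ ζ : ℂ, ‖ζ‖ = 1 → (ev₁ A ζ)ᴴ * ev₁ A ζ = (ev₁ C ζ)ᴴ * ev₁ C ζ)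
    (k : Fin (D + 1)) (i l : n) : bez (D + 1) A C (k, l) (Fin.last D, i) = 0 := by
  rw [← (bez_isHermitian (D + 1) A C).apply, bez_last D A C hA hC hAC, star_zero]

theorem ev₁_gram_apply {a n : Type*} [Fintype a] (D : ℕ) (A : Matrix a n ℂ[X])
    (hA : ∀ i j, (A i j).natDegree ≤ D) (w z : ℂ) (i l : n) :
    ((ev₁ A w)ᴴ * ev₁ A z) i l = ∑ j ∈ Finset.range (D + 1), ∑ k ∈ Finset.range (D + 1),
      (∑ x, conj ((A x i).coeff j) * (A x l).coeff k) * (conj w ^ j * z ^ k) := by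
  simp only [Matrix.mul_apply, Matrix.conjTranspose_apply, ev₁_apply]
  have : ∀ x l z, (A x l).eval z = ∑ k ∈ Finset.range (D + 1), (A x l).coeff k * z ^ k :=
    fun x l z => eval_eq_sum_range' (Nat.lt_succ_of_le (hA x l)) z
  simp only [this, star_sum, star_mul', Finset.sum_mul, star_pow]
  rw [Finset.sum_comm]
  refine Finset.sum_congr rfl fun j _ => ?_
  simp only [Finset.mul_sum]
  rw [Finset.sum_comm]
  refine Finset.sum_congr rfl fun k _ => Finset.sum_congr rfl fun x _ => ?_
  simp only [RCLike.star_def]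
  ring

/-- The Bezoutian identity. -/
theorem gram_sub_gram_eq_bez {a c n : Type*} [Fintype a] [Fintype c] (D : ℕ) (A : Matrix a n ℂ[X])
    (C : Matrix c n ℂ[X]) (hA : ∀ i j, (A i j).natDegree ≤ D) (hC : ∀ i j, (C i j).natDegree ≤ D)
    (hAC : ∀ ζ : ℂ, ‖ζ‖ = 1 → (ev₁ A ζ)ᴴ * ev₁ A ζ = (ev₁ C ζ)ᴴ * ev₁ C ζ) (w z : ℂ) (i l : n) :
    ((ev₁ A w)ᴴ * ev₁ A z - (ev₁ C w)ᴴ * ev₁ C z) i l =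
      (1 - conj w * z) * ∑ j : Fin (D + 1), ∑ k : Fin (D + 1),
        bez (D + 1) A C (j, i) (k, l) * (conj w ^ (j : ℕ) * z ^ (k : ℕ)) := by
  let E : ℕ → ℕ → ℂ := fun j k => ∑ x, conj ((A x i).coeff j) * (A x l).coeff k -
    ∑ x, conj ((C x i).coeff j) * (C x l).coeff k
  have hE : ∀ j k : Fin (D + 1), bez (D + 1) A C (j, i) (k, l) = diagSum E j k := fun j k => by
    rw [bez, Matrix.sub_apply, toep_gram_apply, toep_gram_apply, diagSum_sub]
  rw [Matrix.sub_apply, ev₁_gram_apply D A hA, ev₁_gram_apply D C hC]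
  simp only [← Finset.sum_sub_distrib, ← sub_mul]
  rw [sum_eq_mul_sum_diagSum E D]
  · simp only [hE]
    rw [Fin.sum_univ_eq_sum_range (fun j : ℕ => ∑ k : Fin (D + 1),
      diagSum E j k * (conj w ^ (j : ℕ) * z ^ (k : ℕ)))]
    congr 1
    refine Finset.sum_congr rfl fun j _ => ?_
    rw [Fin.sum_univ_eq_sum_range (fun k : ℕ => diagSum E j k * (conj w ^ j * z ^ k))]
  · intro k hk
    have := bez_last D A C hA hC hAC ⟨k, by omega⟩ i l
    rwa [hE] at this
  · intro k hk
    have := bez_last' D A C hA hC hAC ⟨k, by omega⟩ l i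
    rwa [hE] at this

/-- If the blocks of `v` are read as coefficients in reverse order, block `m` of the Toeplitz
product is the coefficient of degree `D - m` of `A f`. This turns positivity of the Bezoutian into
the comparison `sum_tsq_le` of truncations. -/
theorem sum_norm_sq_toep {a n : Type*} [Fintype a] [Fintype n] (D : ℕ) (A : Matrix a n ℂ[X])
    (v : Fin (D + 1) × n → ℂ) :
    ∑ x, ‖(toep (D + 1) A *ᵥ v) x‖ ^ 2 = ∑ i, tsq (D + 1)
      ((A *ᵥ fun j => ∑ k : Fin (D + 1), C (v (k, j)) * X ^ (D - k)) i) := by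
  rw [Fintype.sum_prod_type, Finset.sum_comm]
  refine Finset.sum_congr rfl fun i _ => ?_
  rw [tsq, ← Finset.sum_range_reflect, ← Fin.sum_univ_eq_sum_range
    (fun m => ‖((A *ᵥ fun j => ∑ k : Fin (D + 1), C (v (k, j)) * X ^ (D - k)) i).coeff
      (D + 1 - 1 - m)‖ ^ 2)]
  refine Finset.sum_congr rfl fun m _ => ?_
  congr 2
  simp only [Matrix.mulVec, dotProduct, Fintype.sum_prod_type, finsetSum_coeff, Finset.mul_sum]
  rw [Finset.sum_comm]
  refine Finset.sum_congr rfl fun j _ => Finset.sum_congr rfl fun k _ => ?_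
  have hm := m.2
  have hk := k.2
  rw [mul_left_comm, coeff_C_mul, coeff_mul_X_pow', toep, Matrix.of_apply]
  by_cases h : m ≤ k
  · have h' : (m : ℕ) ≤ k := h
    rw [if_pos h, if_pos (by omega), mul_comm]
    congr 2
    change (k - m : ℕ) = D + 1 - 1 - m - (D - k)
    omega
  · have h' : ¬ (m : ℕ) ≤ k := h
    rw [if_neg h, if_neg (by omega), zero_mul, mul_zero]

theorem bez_posSemidef {a c n : Type*} [Fintype a] [DecidableEq a] [Fintype c] [Fintype n] (D : ℕ)
    (A : Matrix a n ℂ[X]) (C : Matrix c n ℂ[X])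
    (hAC : ∀ ζ : ℂ, ‖ζ‖ = 1 → (ev₁ A ζ)ᴴ * ev₁ A ζ = (ev₁ C ζ)ᴴ * ev₁ C ζ)
    (hA : ∀ ζ : ℂ, ‖ζ‖ < 1 → ∃ B : Matrix n a ℂ, ev₁ A ζ * B = 1) :
    (bez (D + 1) A C).PosSemidef := by
  refine posSemidef_iff_dotProduct_mulVec.2 ⟨bez_isHermitian _ _ _, fun v => ?_⟩
  rw [bez, Matrix.sub_mulVec, dotProduct_sub, ← sum_norm_sq_mulVec, ← sum_norm_sq_mulVec,
    sum_norm_sq_toep, sum_norm_sq_toep, ← Complex.ofReal_sub, Complex.zero_le_real, sub_nonneg]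
  exact sum_tsq_le A C hAC hA _ _

open scoped MatrixOrder in
theorem PosSemidef.exists_gram {n : Type*} [Fintype n] {P : Matrix n n ℂ}
    (hP : P.PosSemidef) : ∃ (s : ℕ) (L : Matrix (Fin s) n ℂ), P = Lᴴ * L := by
  classical
  obtain ⟨B, hB⟩ := CStarAlgebra.nonneg_iff_eq_star_mul_self.1 hP.nonneg
  let e := Fintype.equivFin n
  refine ⟨_, B.submatrix e.symm id, ?_⟩
  rw [hB, conjTranspose_submatrix, submatrix_mul_equiv, submatrix_id_id]
  rfl

/-- The kernel `(A(w)* A(z) - C(w)* C(z)) / (1 - w̄ z)` is a positive polynomial kernel. -/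
theorem exists_gram_of_isometric {a c n : Type*} [Fintype a] [DecidableEq a] [Fintype c]
    [Fintype n] (A : Matrix a n ℂ[X]) (C : Matrix c n ℂ[X])
    (hAC : ∀ ζ : ℂ, ‖ζ‖ = 1 → (ev₁ A ζ)ᴴ * ev₁ A ζ = (ev₁ C ζ)ᴴ * ev₁ C ζ)
    (hA : ∀ ζ : ℂ, ‖ζ‖ < 1 → ∃ B : Matrix n a ℂ, ev₁ A ζ * B = 1) :
    ∃ (s : ℕ) (L : Matrix (Fin s) n ℂ[X]), ∀ w z : ℂ,
      (ev₁ A w)ᴴ * ev₁ A z - (ev₁ C w)ᴴ * ev₁ C z =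
        (1 - conj w * z) • ((ev₁ L w)ᴴ * ev₁ L z) := by
  obtain ⟨D, hD⟩ : ∃ D, (∀ i j, (A i j).natDegree ≤ D) ∧ ∀ i j, (C i j).natDegree ≤ D :=
    ⟨max (Finset.univ.sup fun i => Finset.univ.sup fun j => (A i j).natDegree)
      (Finset.univ.sup fun i => Finset.univ.sup fun j => (C i j).natDegree),
      fun i j => le_max_of_le_left ((Finset.le_sup (f := fun j => (A i j).natDegree)
        (Finset.mem_univ j)).trans (Finset.le_sup (f := fun i => Finset.univ.sup fun j =>
          (A i j).natDegree) (Finset.mem_univ i))),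
      fun i j => le_max_of_le_right ((Finset.le_sup (f := fun j => (C i j).natDegree)
        (Finset.mem_univ j)).trans (Finset.le_sup (f := fun i => Finset.univ.sup fun j =>
          (C i j).natDegree) (Finset.mem_univ i)))⟩
  obtain ⟨s, L, hL⟩ := PosSemidef.exists_gram (bez_posSemidef D A C hAC hA)
  refine ⟨s, Matrix.of fun x i => ∑ k : Fin (D + 1), Polynomial.C (L x (k, i)) * X ^ (k : ℕ),
    fun w z => ?_⟩
  ext i l
  rw [gram_sub_gram_eq_bez D A C hD.1 hD.2 hAC, Matrix.smul_apply, smul_eq_mul, hL]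
  congr 1
  simp only [Matrix.mul_apply, Matrix.conjTranspose_apply, ev₁_apply, Matrix.of_apply,
    eval_finsetSum, eval_mul, eval_C, eval_pow, eval_X, star_sum,
    Finset.sum_mul, star_mul', star_pow, RCLike.star_def]
  symm
  rw [Finset.sum_comm]
  refine Finset.sum_congr rfl fun j _ => ?_
  simp only [Finset.mul_sum]
  rw [Finset.sum_comm]
  exact Finset.sum_congr rfl fun k _ => Finset.sum_congr rfl fun x _ => by ring

end Bidisk

/-! ### Inner products of coefficients and Hilbert space completions -/

namespace Bidisk

/-- The inner product of the coefficient sequences. -/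
def cip (a b : ℂ[X]) : ℂ := ∑ k ∈ b.support, conj (a.coeff k) * b.coeff k

theorem cip_eq_right {a b : ℂ[X]} {d : ℕ} (h : b.natDegree < d) :
    cip a b = ∑ k ∈ Finset.range d, conj (a.coeff k) * b.coeff k := by
  refine Finset.sum_subset (fun k hk => ?_) fun k _ hk => ?_
  · exact Finset.mem_range.2 ((le_natDegree_of_mem_supp k hk).trans_lt h)
  · simp [notMem_support_iff.1 hk]

theorem cip_eq_left {a b : ℂ[X]} {d : ℕ} (h : a.natDegree < d) :
    cip a b = ∑ k ∈ Finset.range d, conj (a.coeff k) * b.coeff k := by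
  rw [cip_eq_right (lt_max_of_lt_right (Nat.lt_succ_self b.natDegree) : _ < max d _)]
  symm
  refine Finset.sum_subset (Finset.range_subset_range.2 (le_max_left _ _)) fun k _ hk => ?_
  rw [coeff_eq_zero_of_natDegree_lt (by simp at hk; omega), map_zero, zero_mul]

theorem cip_conj (a b : ℂ[X]) : conj (cip b a) = cip a b := by
  rw [cip_eq_right (Nat.lt_succ_self a.natDegree), cip_eq_left (Nat.lt_succ_self a.natDegree)]
  simp [mul_comm]

theorem cip_self (a : ℂ[X]) : cip a a = nsq a := by
  simp [cip, nsq, Complex.conj_mul']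

theorem cip_add_left (a b c : ℂ[X]) : cip (a + b) c = cip a c + cip b c := by
  simp [cip, add_mul, Finset.sum_add_distrib]

theorem cip_smul_left (r : ℂ) (a b : ℂ[X]) : cip (r • a) b = conj r * cip a b := by
  simp [cip, Finset.mul_sum, mul_assoc]

theorem cip_X_mul (a b : ℂ[X]) : cip (X * a) (X * b) = cip a b := by
  have h : (X * b).natDegree < b.natDegree + 2 := by
    have := natDegree_mul_le (p := X) (q := b)
    simp at this
    omega
  rw [cip_eq_right h, cip_eq_right (Nat.lt_succ_self _), Finset.sum_range_succ']
  simp [coeff_X_mul]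

theorem cip_X_pow_mul_eq_zero {a : ℂ[X]} {d : ℕ} (h : a.natDegree < d) (b : ℂ[X]) :
    cip a (X ^ d * b) = 0 := by
  rw [cip_eq_left h]
  refine Finset.sum_eq_zero fun k hk => ?_
  have := Finset.mem_range.1 hk
  rw [coeff_X_pow_mul', if_neg (by omega), mul_zero]

/-- This translates between identities on the circle, tested on coefficients of `crossPoly`, and
inner products of shifted polynomials in the Hilbert space model. -/
theorem coeff_crossPoly_eq_cip {D : ℕ} {a : ℂ[X]} (ha : a.natDegree ≤ D) (b : ℂ[X]) (k : ℕ) : (crossPoly D a b).coeff k = cip (X ^ k * a) (X ^ D * b) := by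
  have h : (X ^ k * a).natDegree < D + k + 1 := by
    have := natDegree_mul_le (p := X ^ k) (q := a)
    simp at this
    omega
  rw [cip_eq_left h, ← Finset.sum_range_reflect, crossPoly, coeff_mul,
    Finset.Nat.sum_antidiagonal_eq_sum_range_succ_mk]
  refine Finset.sum_subset_zero_on_sdiff (Finset.range_subset_range.2 (by omega))
    (fun m hm => ?_) fun m hm => ?_
  · simp only [Finset.mem_sdiff, Finset.mem_range] at hm
    rw [coeff_X_pow_mul' b, if_neg (by omega), mul_zero]
  · have := Finset.mem_range.1 hm
    have h1 : (X ^ D * b).coeff (D + k + 1 - 1 - m) = b.coeff (k - m) := by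
      rw [coeff_X_pow_mul', if_pos (by omega)]
      congr 1
      omega
    have h2 : (X ^ k * a).coeff (D + k + 1 - 1 - m) = a.coeff (revAt D m) := by
      rw [coeff_X_pow_mul']
      by_cases h : m ≤ D
      · rw [revAt_le h, if_pos (by omega)]
        congr 1
        omega
      · rw [revAt_eq_self_of_lt (by omega), if_neg (by omega),
          coeff_eq_zero_of_natDegree_lt (by omega)]
    rw [h1, h2, coeff_reflect, coeff_map]

/-- The form may be degenerate. The completion is separated, so null vectors are sent to zero and
`ι` need not be injective. -/
theorem exists_hilbert_of_core {V : Type} [AddCommGroup V] [Module ℂ V]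
    (c : PreInnerProductSpace.Core ℂ V) :
    ∃ (H : Type) (_ : NormedAddCommGroup H) (_ : InnerProductSpace ℂ H) (_ : CompleteSpace H)
      (ι : V →ₗ[ℂ] H), DenseRange ι ∧ ∀ x y, inner ℂ (ι x) (ι y) = c.inner x y := by
  let _ := c
  let i1 : SeminormedAddCommGroup V := InnerProductSpace.Core.toSeminormedAddCommGroup (𝕜 := ℂ)
  let i2 : InnerProductSpace ℂ V := InnerProductSpace.ofCore c
  refine ⟨UniformSpace.Completion V, inferInstance, inferInstance, inferInstance,
    (UniformSpace.Completion.toComplₗᵢ (𝕜 := ℂ) (E := V)).toLinearMap,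
    UniformSpace.Completion.denseRange_coe, fun x y => ?_⟩
  exact UniformSpace.Completion.inner_coe x y

/-- A linear map that preserves the inner product extends to the Hilbert space completion. -/
theorem exists_isometry_extension {V H : Type*} [AddCommGroup V] [Module ℂ V]
    [NormedAddCommGroup H] [InnerProductSpace ℂ H] [CompleteSpace H] (ι : V →ₗ[ℂ] H)
    (hι : DenseRange ι) (S : V →ₗ[ℂ] V)
    (hS : ∀ x y, inner ℂ (ι (S x)) (ι (S y)) = inner ℂ (ι x) (ι y)) :
    ∃ T : H →L[ℂ] H, (∀ x, T (ι x) = ι (S x)) ∧ ∀ u v, inner ℂ (T u) (T v) = inner ℂ u v := by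
  have hn : ∃ C : ℝ, ∀ x, ‖(ι ∘ₗ S) x‖ ≤ C * ‖ι x‖ := ⟨1, fun x => by
    rw [one_mul, LinearMap.comp_apply, @norm_eq_sqrt_re_inner ℂ, @norm_eq_sqrt_re_inner ℂ _ _ _ _ (ι x),
      hS]⟩
  have hT : ∀ x, (ι ∘ₗ S).extendOfNorm ι (ι x) = ι (S x) :=
    LinearMap.extendOfNorm_eq hι hn
  refine ⟨(ι ∘ₗ S).extendOfNorm ι, hT, fun u v => ?_⟩
  refine hι.induction_on₂ (p := fun u v => inner ℂ ((ι ∘ₗ S).extendOfNorm ι u)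
    ((ι ∘ₗ S).extendOfNorm ι v) = inner ℂ u v) (isClosed_eq (by fun_prop) (by fun_prop)) ?_ u v
  intro x y
  rw [hT, hT, hS]

open ContinuousLinearMap in
-- The projection `1 - T T*` onto `ker T*` kills the range of `T`, so it maps the range of `κ` onto
-- a dense subspace of `ker T*`. That subspace is finite-dimensional, hence closed, hence
-- everything.
theorem finiteDimensional_ker_adjoint {H X : Type*} [NormedAddCommGroup H] [InnerProductSpace ℂ H]
    [CompleteSpace H] [AddCommGroup X] [Module ℂ X] [FiniteDimensional ℂ X] (T : H →L[ℂ] H)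
    (hT : ∀ u v, inner ℂ (T u) (T v) = inner ℂ u v) (κ : X →ₗ[ℂ] H)
    (hκ : Dense {u : H | ∃ x v, u = κ x + T v}) :
    FiniteDimensional ℂ (LinearMap.ker (adjoint T).toLinearMap) := by
  set E := LinearMap.ker (adjoint T).toLinearMap
  have hTT : ∀ u, adjoint T (T u) = u := fun u =>
    ext_inner_right ℂ fun v => by rw [adjoint_inner_left, hT]
  let R : H →L[ℂ] E := (ContinuousLinearMap.id ℂ H - T ∘L adjoint T).codRestrict E fun u => by
    simp [E, hTT]
  have hR : ∀ e : E, R e = e := fun e => by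
    have : adjoint T (e : H) = 0 := e.2
    ext
    simp [R, this]
  let K : Submodule ℂ E := LinearMap.range (R.toLinearMap ∘ₗ κ)
  have hK : IsClosed (K : Set E) := K.closed_of_finiteDimensional
  have hd : Dense (K : Set E) := by
    have h1 : Dense (R '' {u : H | ∃ x v, u = κ x + T v}) :=
      (Function.Surjective.denseRange (f := R) fun e => ⟨(e : H), hR e⟩).dense_image R.continuous hκ
    refine h1.mono ?_
    rintro _ ⟨_, ⟨x, v, rfl⟩, rfl⟩
    refine ⟨x, ?_⟩
    ext
    simp [R, hTT]
  have hK2 : K = ⊤ := by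
    refine SetLike.coe_injective ?_
    rw [← hK.closure_eq, hd.closure_eq]
    rfl
  have : FiniteDimensional ℂ K := inferInstance
  rw [hK2] at this
  exact Module.Finite.equiv (Submodule.topEquiv (R := ℂ) (M := E))

end Bidisk

/-! ### The Wold decomposition and the matrix Fejér-Riesz theorem -/

namespace Bidisk

open ContinuousLinearMap in
theorem inner_pow_eq_inner_adjoint_pow {H : Type*} [NormedAddCommGroup H] [InnerProductSpace ℂ H]
    [CompleteSpace H] (T : H →L[ℂ] H) (t : ℕ) (x u : H) :
    inner ℂ ((T ^ t) x) u = inner ℂ x ((adjoint T ^ t) u) := by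
  induction t generalizing x u with
  | zero => simp
  | succ t ih =>
    rw [pow_succ, pow_succ', mul_apply_eq_comp, mul_apply_eq_comp, ih, ← adjoint_inner_right]

open ContinuousLinearMap in
theorem adjoint_apply_of_isometry {H : Type*} [NormedAddCommGroup H] [InnerProductSpace ℂ H]
    [CompleteSpace H] {T : H →L[ℂ] H} (hT : ∀ u v, inner ℂ (T u) (T v) = inner ℂ u v) (u : H) :
    adjoint T (T u) = u :=
  ext_inner_right ℂ fun v => by rw [adjoint_inner_left, hT]

theorem inner_pow_pow_of_isometry {H : Type*} [NormedAddCommGroup H] [InnerProductSpace ℂ H]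
    {T : H →L[ℂ] H} (hT : ∀ u v, inner ℂ (T u) (T v) = inner ℂ u v) (k : ℕ) (u v : H) :
    inner ℂ ((T ^ k) u) ((T ^ k) v) = inner ℂ u v := by
  induction k with
  | zero => simp
  | succ k ih => rw [pow_succ', mul_apply_eq_comp, mul_apply_eq_comp, hT, ih]

open ContinuousLinearMap in
-- For `k ≤ t` the isometry `T ^ k` cancels; otherwise a vector of `ker T*` is paired with the range
-- of `T`. So `T ^ k` acts on the sequence of Wold coefficients as multiplication by `X ^ k`.
theorem inner_pow_wandering {H : Type*} [NormedAddCommGroup H] [InnerProductSpace ℂ H]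
    [CompleteSpace H] {T : H →L[ℂ] H} (hT : ∀ u v, inner ℂ (T u) (T v) = inner ℂ u v) {e : H}
    (he : adjoint T e = 0) (t k : ℕ) (u : H) :
    inner ℂ ((T ^ t) e) ((T ^ k) u) = if k ≤ t then inner ℂ ((T ^ (t - k)) e) u else 0 := by
  split_ifs with h
  · obtain ⟨s, rfl⟩ := Nat.exists_eq_add_of_le h
    rw [pow_add, mul_apply_eq_comp, inner_pow_pow_of_isometry hT, Nat.add_sub_cancel_left]
  · obtain ⟨s, rfl⟩ := Nat.exists_eq_add_of_lt (not_le.1 h)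
    rw [add_assoc, pow_add, mul_apply_eq_comp, inner_pow_pow_of_isometry hT, pow_succ',
      mul_apply_eq_comp, ← adjoint_inner_left, he, inner_zero_left]

open ContinuousLinearMap in
/-- The Wold decomposition of the inner product with respect to an isometry. -/
theorem inner_eq_sum_wold {H : Type*} [NormedAddCommGroup H] [InnerProductSpace ℂ H]
    [CompleteSpace H] (T : H →L[ℂ] H) (hT : ∀ u v, inner ℂ (T u) (T v) = inner ℂ u v) {r : ℕ}
    (e : OrthonormalBasis (Fin r) ℂ (LinearMap.ker (adjoint T).toLinearMap)) (d : ℕ) (u v : H) :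
    inner ℂ u v = ∑ t ∈ Finset.range d, ∑ x, conj (inner ℂ ((T ^ t) (e x : H)) u) *
        inner ℂ ((T ^ t) (e x : H)) v +
      inner ℂ ((adjoint T ^ d) u) ((adjoint T ^ d) v) := by
  have hTT := adjoint_apply_of_isometry hT
  have hstep : ∀ u v : H, inner ℂ u v = ∑ x, conj (inner ℂ (e x : H) u) * inner ℂ (e x : H) v +
      inner ℂ (adjoint T u) (adjoint T v) := by
    intro u v
    -- `1 - T T*` is the projection onto `ker T*`; Parseval there gives one step of the
    -- decomposition.
    let R : H → LinearMap.ker (adjoint T).toLinearMap := fun u => ⟨u - T (adjoint T u), by simp [hTT]⟩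
    have hR : ∀ x u, inner ℂ (e x) (R u) = inner ℂ (e x : H) u := fun x u => by
      have h0 : adjoint T (e x : H) = 0 := (e x).2
      rw [Submodule.coe_inner, inner_sub_right, ← adjoint_inner_left, h0, inner_zero_left, sub_zero]
    have h1 := e.sum_inner_mul_inner (R u) (R v)
    simp only [hR, ← inner_conj_symm (R u) (e _)] at h1
    have h2 : inner ℂ u (T (adjoint T v)) = inner ℂ (adjoint T u) (adjoint T v) := by
      rw [← adjoint_inner_left]
    have h3 : inner ℂ (T (adjoint T u)) v = inner ℂ (adjoint T u) (adjoint T v) := by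
      rw [← adjoint_inner_right]
    rw [h1, Submodule.coe_inner]
    simp only [R, inner_sub_left, inner_sub_right, h2, h3, hT]
    ring
  induction d with
  | zero => simp
  | succ d ih =>
    rw [ih, hstep ((adjoint T ^ d) u), Finset.sum_range_succ, add_assoc]
    simp only [inner_pow_eq_inner_adjoint_pow T d, pow_succ', mul_apply_eq_comp]

theorem exists_rightInverse_of_vecMul {m n : Type*} [Fintype m] [DecidableEq m] [Fintype n]
    [DecidableEq n] (M : Matrix m n ℂ) (h : ∀ u : m → ℂ, u ᵥ* M = 0 → u = 0) :
    ∃ B : Matrix n m ℂ, M * B = 1 := by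
  obtain ⟨g, hg⟩ := LinearMap.exists_leftInverse_of_injective (Mᵀ.mulVecLin)
    (LinearMap.ker_eq_bot'.2 fun u hu => h u (by simpa [Matrix.mulVec_transpose] using hu))
  refine ⟨(LinearMap.toMatrix' g)ᵀ, ?_⟩
  have := congrArg LinearMap.toMatrix' hg
  rw [LinearMap.toMatrix'_comp, LinearMap.toMatrix'_id] at this
  rw [← Matrix.transpose_inj, Matrix.transpose_mul, Matrix.transpose_transpose,
    Matrix.transpose_one, ← this]
  congr 1
  exact (LinearMap.toMatrix'_toLin' Mᵀ).symm

/-- The inner product on polynomial vectors defined by a nonnegative trigonometric matrix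
polynomial that is given as a difference of two Gram matrices. -/
abbrev formCore {a c n : Type*} [Fintype a] [Fintype c] [Fintype n] (Y : Matrix a n ℂ[X])
    (W : Matrix c n ℂ[X])
    (h : ∀ ζ : ℂ, ‖ζ‖ = 1 → ((ev₁ Y ζ)ᴴ * ev₁ Y ζ - (ev₁ W ζ)ᴴ * ev₁ W ζ).PosSemidef) :
    PreInnerProductSpace.Core ℂ (n → ℂ[X]) where
  inner f g := ∑ i, cip ((Y *ᵥ f) i) ((Y *ᵥ g) i) - ∑ i, cip ((W *ᵥ f) i) ((W *ᵥ g) i)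
  conj_inner_symm f g := by simp only [map_sub, map_sum, cip_conj]
  re_inner_nonneg f := by
    simp only [cip_self, ← Complex.ofReal_sum, ← Complex.ofReal_sub, RCLike.re_to_complex,
      Complex.ofReal_re, sub_nonneg]
    refine sum_nsq_le _ _ fun ζ hζ => ?_
    have := (posSemidef_iff_dotProduct_mulVec.1 (h ζ hζ)).2 fun j => (f j).eval ζ
    rw [Matrix.sub_mulVec, dotProduct_sub, ← sum_norm_sq_mulVec, ← sum_norm_sq_mulVec,
      ← Complex.ofReal_sub, Complex.zero_le_real, sub_nonneg] at this
    simpa only [ev₁_mulVec] using this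
  add_left f g h := by
    simp only [Matrix.mulVec_add, Pi.add_apply, cip_add_left, Finset.sum_add_distrib]
    ring
  smul_left f g r := by
    simp only [Matrix.mulVec_smul, Pi.smul_apply, cip_smul_left, ← Finset.mul_sum, mul_sub]

theorem exists_natDegree_le {m n : Type*} [Fintype m] [Fintype n] (A : Matrix m n ℂ[X]) :
    ∃ D, ∀ d, D ≤ d → ∀ i j, (A i j).natDegree ≤ d :=
  ⟨Finset.univ.sup fun i => Finset.univ.sup fun j => (A i j).natDegree, fun _ hd i j =>
    ((Finset.le_sup (f := fun j => (A i j).natDegree) (Finset.mem_univ j)).trans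
      (Finset.le_sup (f := fun i => Finset.univ.sup fun j => (A i j).natDegree)
        (Finset.mem_univ i))).trans hd⟩

theorem mulVec_X_pow_smul_single {m n : Type*} [Fintype n] [DecidableEq n] (A : Matrix m n ℂ[X])
    (k : ℕ) (i : m) (j : n) : (A *ᵥ ((X ^ k : ℂ[X]) • Pi.single j 1)) i = X ^ k * A i j := by
  rw [Matrix.mulVec_smul, Matrix.mulVec_single_one]
  rfl

/-- A polynomial vector space with its shift, inside a Hilbert space with an isometry. -/
structure ShiftModel {n : Type} {H : Type} [NormedAddCommGroup H] [InnerProductSpace ℂ H]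
    [CompleteSpace H] (ι : (n → ℂ[X]) →ₗ[ℂ] H) (T : H →L[ℂ] H) : Prop where
  dense : DenseRange ι
  shift : ∀ (d : ℕ) f, (T ^ d) (ι f) = ι ((X ^ d : ℂ[X]) • f)
  isometry : ∀ u v, inner ℂ (T u) (T v) = inner ℂ u v

/-- The form depends only on coefficient inner products, which do not change when both arguments are
multiplied by `X`. So multiplication by `X` extends to an isometry of the completion. -/
theorem exists_shiftModel {a c n : Type} [Fintype a] [Fintype c] [Fintype n]
    (Y : Matrix a n ℂ[X]) (W : Matrix c n ℂ[X])
    (h : ∀ ζ : ℂ, ‖ζ‖ = 1 → ((ev₁ Y ζ)ᴴ * ev₁ Y ζ - (ev₁ W ζ)ᴴ * ev₁ W ζ).PosSemidef) :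
    ∃ (H : Type) (_ : NormedAddCommGroup H) (_ : InnerProductSpace ℂ H) (_ : CompleteSpace H)
      (ι : (n → ℂ[X]) →ₗ[ℂ] H) (T : H →L[ℂ] H), ShiftModel ι T ∧ ∀ f g, inner ℂ (ι f) (ι g) =
        ∑ i, cip ((Y *ᵥ f) i) ((Y *ᵥ g) i) - ∑ i, cip ((W *ᵥ f) i) ((W *ᵥ g) i) := by
  obtain ⟨H, _, _, _, ι, hι, hin⟩ := exists_hilbert_of_core (formCore Y W h)
  replace hin : ∀ f g, inner ℂ (ι f) (ι g) =
    ∑ i, cip ((Y *ᵥ f) i) ((Y *ᵥ g) i) - ∑ i, cip ((W *ᵥ f) i) ((W *ᵥ g) i) := hin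
  let S : (n → ℂ[X]) →ₗ[ℂ] (n → ℂ[X]) :=
    LinearMap.pi fun i => LinearMap.mulLeft ℂ X ∘ₗ LinearMap.proj i
  have hSf : ∀ f, S f = (X : ℂ[X]) • f := fun f => rfl
  obtain ⟨T, hTι, hT⟩ := exists_isometry_extension ι hι S fun f g => by
    simp only [hin, hSf, Matrix.mulVec_smul, Pi.smul_apply, smul_eq_mul, cip_X_mul]
  refine ⟨H, _, _, _, ι, T, ⟨hι, fun d f => ?_, hT⟩, hin⟩
  induction d with
  | zero => simp
  | succ d ih => rw [pow_succ', mul_apply_eq_comp, ih, hTι, hSf, smul_smul, pow_succ']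

namespace ShiftModel

variable {n : Type} {H : Type} [NormedAddCommGroup H] [InnerProductSpace ℂ H]
    [CompleteSpace H] {ι : (n → ℂ[X]) →ₗ[ℂ] H} {T : H →L[ℂ] H}

open ContinuousLinearMap in
-- Each polynomial vector is its constant term plus a multiple of `X`, so the constants and the
-- range of `T` together are dense.
theorem finiteDimensional [Fintype n] (h : ShiftModel ι T) :
    FiniteDimensional ℂ (LinearMap.ker (adjoint T).toLinearMap) := by
  let κ : (n → ℂ) →ₗ[ℂ] H :=
    ι ∘ₗ LinearMap.pi fun i => Polynomial.CAlgHom.toLinearMap ∘ₗ LinearMap.proj i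
  refine finiteDimensional_ker_adjoint T h.isometry κ (h.dense.mono ?_)
  rintro _ ⟨f, rfl⟩
  refine ⟨fun i => (f i).coeff 0, ι fun i => (f i).divX, ?_⟩
  have h1 := h.shift 1 fun i => (f i).divX
  rw [pow_one, pow_one] at h1
  rw [h1]
  simp only [κ, LinearMap.comp_apply]
  rw [← map_add]
  congr 1
  ext1 i
  have := X_mul_divX_add (f i)
  simp only [Pi.add_apply, LinearMap.pi_apply, LinearMap.comp_apply, LinearMap.proj_apply,
    AlgHom.toLinearMap_apply, Pi.smul_apply, smul_eq_mul]
  rw [add_comm]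
  exact this.symm

theorem eq_zero_of_inner_eq_zero [Finite n] [DecidableEq n] (h : ShiftModel ι T) (u : H)
    (hu : ∀ (k : ℕ) (j : n), inner ℂ u (ι ((X ^ k : ℂ[X]) • Pi.single j 1)) = 0) : u = 0 := by
  have h0 : (innerSL ℂ u).toLinearMap ∘ₗ ι = 0 := by
    refine LinearMap.pi_ext' fun j => Polynomial.lhom_ext' fun k => LinearMap.ext_ring ?_
    have : (Pi.single j (monomial k (1 : ℂ)) : n → ℂ[X]) = (X ^ k : ℂ[X]) • Pi.single j 1 := by
      rw [← Pi.single_smul', smul_eq_mul, mul_one, monomial_one_right_eq_X_pow]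
    simpa [this] using hu k j
  refine h.dense.eq_zero_of_inner_left ℂ ?_
  exact fun f => LinearMap.congr_fun h0 f

end ShiftModel

open ContinuousLinearMap in
/-- The matrix Fejér-Riesz theorem, with an outer factor. -/
theorem exists_outer_factor {a c n : Type} [Fintype a] [Fintype c] [Fintype n] [DecidableEq n]
    (Y : Matrix a n ℂ[X]) (W : Matrix c n ℂ[X])
    (h : ∀ ζ : ℂ, ‖ζ‖ = 1 → ((ev₁ Y ζ)ᴴ * ev₁ Y ζ - (ev₁ W ζ)ᴴ * ev₁ W ζ).PosSemidef) :
    ∃ (r : ℕ) (A : Matrix (Fin r) n ℂ[X]),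
      (∀ ζ : ℂ, ‖ζ‖ = 1 →
        (ev₁ A ζ)ᴴ * ev₁ A ζ = (ev₁ Y ζ)ᴴ * ev₁ Y ζ - (ev₁ W ζ)ᴴ * ev₁ W ζ) ∧
      ∀ ζ : ℂ, ‖ζ‖ < 1 → ∃ B : Matrix n (Fin r) ℂ, ev₁ A ζ * B = 1 := by
  obtain ⟨DY, hDY⟩ := exists_natDegree_le Y
  obtain ⟨DW, hDW⟩ := exists_natDegree_le W
  set D := max DY DW
  replace hDY := hDY D (le_max_left _ _)
  replace hDW := hDW D (le_max_right _ _)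
  obtain ⟨H, _, _, _, ι, T, hM, hin⟩ := exists_shiftModel Y W h
  have hT := hM.isometry
  have hTT := adjoint_apply_of_isometry hT
  have hfin := hM.finiteDimensional
  obtain ⟨r, e, he, hind, hwold⟩ : ∃ (r : ℕ) (e : Fin r → H), (∀ x, adjoint T (e x) = 0) ∧
      LinearIndependent ℂ e ∧ ∀ (d : ℕ) (u v : H), inner ℂ u v =
        ∑ t ∈ Finset.range d, ∑ x, conj (inner ℂ ((T ^ t) (e x)) u) * inner ℂ ((T ^ t) (e x)) v +
          inner ℂ ((adjoint T ^ d) u) ((adjoint T ^ d) v) := by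
    let e := stdOrthonormalBasis ℂ (LinearMap.ker (adjoint T).toLinearMap)
    exact ⟨_, fun x => e x, fun x => (e x).2,
      e.orthonormal.linearIndependent.map' (Submodule.subtype _) (Submodule.ker_subtype _),
      inner_eq_sum_wold T hT e⟩
  let δ : n → (n → ℂ[X]) := fun j => Pi.single j 1
  have hinδ : ∀ k l i j, inner ℂ (ι ((X ^ k : ℂ[X]) • δ i)) (ι ((X ^ l : ℂ[X]) • δ j)) =
      ∑ x, cip (X ^ k * Y x i) (X ^ l * Y x j) - ∑ x, cip (X ^ k * W x i) (X ^ l * W x j) := by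
    intro k l i j
    simp only [hin, δ, mulVec_X_pow_smul_single]
  -- The form has finite bandwidth: once `d > D + k`, the multiples of `X ^ d` are orthogonal to `X
  -- ^ k δ j`. This makes the Wold coefficients finite in number and removes the remainder term.
  have hker : ∀ (k d : ℕ) (j : n), D + k < d → (adjoint T ^ d) (ι ((X ^ k : ℂ[X]) • δ j)) = 0 := by
    intro k d j hd
    have hdeg : ∀ q : ℂ[X], q.natDegree ≤ D → (X ^ k * q).natDegree < d := fun q hq => by
      have := natDegree_mul_le (p := X ^ k) (q := q)
      simp at this
      omega
    refine hM.eq_zero_of_inner_eq_zero _ fun l i => ?_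
    rw [← inner_conj_symm, ← inner_pow_eq_inner_adjoint_pow, hM.shift, inner_conj_symm, smul_smul,
      ← pow_add, hinδ]
    simp only [pow_add X d l, mul_assoc, cip_X_pow_mul_eq_zero (hdeg _ (hDY _ _)),
      cip_X_pow_mul_eq_zero (hdeg _ (hDW _ _)), Finset.sum_const_zero, sub_self]
  -- The entries of `A` have the Wold coefficients of the constant vectors `δ j` as their
  -- coefficients.
  let A : Matrix (Fin r) n ℂ[X] := Matrix.of fun x j =>
    ∑ k ∈ Finset.range (D + 1), C (inner ℂ ((T ^ k) (e x)) (ι (δ j))) * X ^ k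
  have hAc : ∀ x j k, (A x j).coeff k = inner ℂ ((T ^ k) (e x)) (ι (δ j)) := by
    intro x j k
    simp only [A, Matrix.of_apply, finsetSum_coeff, coeff_C_mul, coeff_X_pow, mul_ite, mul_one,
      mul_zero, Finset.sum_ite_eq, Finset.mem_range]
    split_ifs with hk
    · rfl
    · have := hker 0 k j (by omega)
      rw [pow_zero, one_smul] at this
      rw [inner_pow_eq_inner_adjoint_pow, this, inner_zero_right]
  have hAd : ∀ x j, (A x j).natDegree ≤ D := fun x j => by
    refine natDegree_le_iff_coeff_eq_zero.2 fun k hk => ?_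
    have := hker 0 k j (by omega)
    rw [pow_zero, one_smul] at this
    rw [hAc, inner_pow_eq_inner_adjoint_pow, this, inner_zero_right]
  have hAX : ∀ x j k t, (X ^ k * A x j).coeff t =
      inner ℂ ((T ^ t) (e x)) (ι ((X ^ k : ℂ[X]) • δ j)) := by
    intro x j k t
    rw [coeff_X_pow_mul', ← hM.shift, inner_pow_wandering hT (he x), hAc]
  refine ⟨r, A, fun ζ hζ => ?_, fun ζ hζ => ?_⟩
  · have hp : ∀ i j, ∑ x, crossPoly D (A x i) (A x j) =
        ∑ x, crossPoly D (Y x i) (Y x j) - ∑ x, crossPoly D (W x i) (W x j) := by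
      intro i j
      ext k
      have h1 := hwold (D + k + 1) (ι ((X ^ k : ℂ[X]) • δ i))
        (ι ((X ^ D : ℂ[X]) • δ j))
      rw [hker k _ i (by omega), inner_zero_left, add_zero, hinδ] at h1
      simp only [coeff_sub, finsetSum_coeff, coeff_crossPoly_eq_cip (hAd _ _),
        coeff_crossPoly_eq_cip (hDY _ _), coeff_crossPoly_eq_cip (hDW _ _)]
      rw [h1, Finset.sum_comm]
      refine Finset.sum_congr rfl fun x _ => ?_
      -- `X ^ k * A x i` has degree at most `D + k`, so the finite Wold sum is the whole coefficient
      -- inner product.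
      rw [cip_eq_left (d := D + k + 1)]
      · simp only [hAX]
      · have := natDegree_mul_le (p := X ^ k) (q := A x i)
        have := hAd x i
        simp at *
        omega
    have hζ0 : ζ ^ D ≠ 0 := pow_ne_zero _ (by rintro rfl; simp at hζ)
    ext i j
    have h1 := congrArg (eval ζ) (hp i j)
    simp only [eval_sub, eval_finsetSum, eval_crossPoly (hAd _ _) _ hζ,
      eval_crossPoly (hDY _ _) _ hζ, eval_crossPoly (hDW _ _) _ hζ, ← Finset.sum_mul,
      ← sub_mul] at h1
    simpa only [Matrix.sub_apply, Matrix.mul_apply, Matrix.conjTranspose_apply, ev₁_apply,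
      RCLike.star_def] using
      mul_right_cancel₀ hζ0 h1
  · refine exists_rightInverse_of_vecMul _ fun u hu => ?_
    -- A left null vector `u` of `A(ζ)` gives `e₀` in `ker T*`. The vector `g = (1 - ζ̄ T)⁻¹ e₀` is
    -- an eigenvector of `T*`, and its inner products with the constants `δ j` are the entries of `u
    -- A(ζ)`. So `g` is orthogonal to all polynomial vectors, which forces `g = 0`, `e₀ = 0` and `u
    -- = 0`.
    let e₀ : H := ∑ x, conj (u x) • e x
    have he₀ : adjoint T e₀ = 0 := by simp [e₀, he]
    have hTn : ‖conj ζ • T‖ < 1 := by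
      have h1 : ‖T‖ ≤ 1 := T.opNorm_le_bound zero_le_one fun v => by
        rw [one_mul, @norm_eq_sqrt_re_inner ℂ, @norm_eq_sqrt_re_inner ℂ _ _ _ _ v, hT]
      rw [norm_smul, RCLike.norm_conj]
      nlinarith [norm_nonneg ζ, norm_nonneg T]
    obtain ⟨N, hN⟩ := (isUnit_one_sub_of_norm_lt_one hTn).exists_right_inv
    obtain ⟨g, hg⟩ : ∃ g : H, g = e₀ + conj ζ • T g := by
      refine ⟨N e₀, ?_⟩
      have := congrArg (fun L : H →L[ℂ] H => L e₀) hN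
      simp only [mul_apply_eq_comp, _root_.sub_apply, one_apply_eq_self,
        _root_.smul_apply] at this
      exact sub_eq_iff_eq_add.1 this
    have hTg : adjoint T g = conj ζ • g := by
      conv_lhs => rw [hg, map_add, map_smul, he₀, hTT, zero_add]
    have hgp : ∀ (k : ℕ) (v : H), inner ℂ g ((T ^ k) v) = ζ ^ k * inner ℂ g v := by
      intro k v
      induction k with
      | zero => simp
      | succ k ih =>
        rw [pow_succ', mul_apply_eq_comp, ← adjoint_inner_left, hTg, inner_smul_left, ih,
          Complex.conj_conj]
        ring
    have hsum : ∀ (d : ℕ) (v : H), inner ℂ g v =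
        ∑ k ∈ Finset.range d, ζ ^ k * inner ℂ ((T ^ k) e₀) v + ζ ^ d * inner ℂ ((T ^ d) g) v := by
      intro d v
      induction d with
      | zero => simp
      | succ d ih =>
        have h1 : (T ^ d) g = (T ^ d) e₀ + conj ζ • (T ^ (d + 1)) g := by
          conv_lhs => rw [hg]
          rw [map_add, map_smul, pow_succ, mul_apply_eq_comp]
        rw [ih, Finset.sum_range_succ, h1, inner_add_left, inner_smul_left, Complex.conj_conj]
        ring
    have hgδ : ∀ j, inner ℂ g (ι (δ j)) = 0 := by
      intro j
      have h1 := hker 0 (D + 1) j (by omega)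
      rw [pow_zero, one_smul] at h1
      have h2 := congrFun hu j
      simp only [Matrix.vecMul, dotProduct, ev₁_apply, Pi.zero_apply] at h2
      rw [hsum (D + 1), inner_pow_eq_inner_adjoint_pow, h1, inner_zero_right, mul_zero, add_zero,
        ← h2]
      simp only [eval_eq_sum_range' (Nat.lt_succ_of_le (hAd _ _)), hAc, Finset.mul_sum, e₀, map_sum,
        map_smul, sum_inner, inner_smul_left, Complex.conj_conj]
      rw [Finset.sum_comm]
      exact Finset.sum_congr rfl fun x _ => Finset.sum_congr rfl fun k _ => by ring
    have hg0 : g = 0 := hM.eq_zero_of_inner_eq_zero g fun k j => by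
      rw [← hM.shift, hgp, hgδ, mul_zero]
    have h0 : e₀ = 0 := by simpa [hg0] using hg.symm
    ext x
    have := Fintype.linearIndependent_iff.1 hind _ h0 x
    simpa using this

end Bidisk

/-! ### Slices, zeros on the boundary, and isometry on the torus -/

namespace Bidisk

/-- The polynomial in `z₁` that is obtained by fixing `z₂`. -/
def slice (p : BiPoly) (ζ : ℂ) : ℂ[X] := p.map (evalRingHom ζ)

theorem eval_slice (p : BiPoly) (z ζ : ℂ) : (slice p ζ).eval z = ev p (z, ζ) := by
  rw [slice, ev, map_evalRingHom_eval]

theorem ev_eq_sum (p : BiPoly) {d : ℕ} (hd : p.natDegree < d) (z : ℂ × ℂ) :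
    ev p z = ∑ k ∈ Finset.range d, (p.coeff k).eval z.2 * z.1 ^ k := by
  rw [← Prod.mk.eta (p := z), ← eval_slice, slice,
    eval_eq_sum_range' (lt_of_le_of_lt natDegree_map_le hd)]
  simp

theorem differentiable_ev (p : BiPoly) : Differentiable ℂ (ev p) := by
  have : ev p = fun z => ∑ k ∈ Finset.range (p.natDegree + 1), (p.coeff k).eval z.2 * z.1 ^ k :=
    funext (ev_eq_sum p (Nat.lt_succ_self _))
  rw [this]
  refine Differentiable.fun_sum fun k _ => ?_
  exact ((p.coeff k).differentiable.comp differentiable_snd).mul (differentiable_fst.pow k)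

theorem continuous_ev (p : BiPoly) : Continuous (ev p) := (differentiable_ev p).continuous

open Filter Topology in
/-- Hurwitz: a boundary slice of a polynomial without zeros in the bidisk has no zeros in the
disk, unless it vanishes identically. -/
theorem slice_eq_zero_or_ne_zero (p : BiPoly) (hp : ∀ z ∈ bidisk, ev p z ≠ 0) {ζ : ℂ}
    (hζ : ‖ζ‖ = 1) : slice p ζ = 0 ∨ ∀ z : ℂ, ‖z‖ < 1 → (slice p ζ).eval z ≠ 0 := by
  by_contra! hcon
  obtain ⟨h0, a, ha, hpa⟩ := hcon
  -- The slice has finitely many roots, so some circle around `a` inside the disk avoids them.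
  obtain ⟨R, ⟨hR0, hR1⟩, hR⟩ : ∃ R ∈ Set.Ioo 0 (1 - ‖a‖),
      R ∉ (slice p ζ).roots.toFinset.image fun x => ‖x - a‖ :=
    (Set.Ioo_infinite (by linarith)).exists_notMem_finset _
  have hball : ∀ z ∈ Metric.closedBall a R, ‖z‖ < 1 := fun z hz => by
    have h1 : ‖z - a‖ ≤ R := by simpa [dist_eq_norm] using hz
    have h2 := norm_add_le (z - a) a
    rw [sub_add_cancel] at h2
    linarith
  have hK := isCompact_sphere a R
  have hne : ∀ z ∈ Metric.sphere a R, ev p (z, ζ) ≠ 0 := fun z hz h => by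
    refine hR (Finset.mem_image.2 ⟨z, ?_, by simpa [dist_eq_norm] using hz⟩)
    rw [Multiset.mem_toFinset, mem_roots h0, IsRoot, eval_slice, h]
  obtain ⟨z₀, hz₀, hmin⟩ := hK.exists_isMinOn (NormedSpace.sphere_nonempty.2 hR0.le)
    (f := fun z => ‖ev p (z, ζ)‖) (by have := continuous_ev p; fun_prop)
  set δ := ‖ev p (z₀, ζ)‖
  have hδ : 0 < δ := norm_pos_iff.2 (hne z₀ hz₀)
  have hcont : Continuous fun x : ℂ × ℝ => ‖ev p (x.1, (x.2 : ℂ) * ζ)‖ := by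
    have := continuous_ev p
    fun_prop
  have h1 : ∀ᶠ t : ℝ in 𝓝 1, ∀ z ∈ Metric.sphere a R, δ / 2 < ‖ev p (z, (t : ℂ) * ζ)‖ := by
    refine hK.eventually_forall_of_forall_eventually fun z hz => ?_
    refine ((hcont.comp continuous_swap).tendsto ((1 : ℝ), z)).eventually_const_lt ?_
    have : δ ≤ ‖ev p (z, ζ)‖ := hmin hz
    simp only [Function.comp_apply, Prod.swap_prod_mk, Complex.ofReal_one, one_mul]
    linarith
  have h2 : ∀ᶠ t : ℝ in 𝓝 1, ‖ev p (a, (t : ℂ) * ζ)‖ < δ / 2 := by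
    have hc : Continuous fun t : ℝ => ‖ev p (a, (t : ℂ) * ζ)‖ :=
      hcont.comp (continuous_const.prodMk continuous_id)
    refine (hc.tendsto 1).eventually_lt_const ?_
    rw [eval_slice] at hpa
    simp [hpa, hδ]
  have h3 : ∀ᶠ t : ℝ in 𝓝[<] 1, 0 < t :=
    (eventually_gt_nhds zero_lt_one).filter_mono nhdsWithin_le_nhds
  obtain ⟨t, ⟨⟨ht1, ht2⟩, ht0⟩, htl⟩ := (((h1.and h2).filter_mono nhdsWithin_le_nhds).and h3 |>.and
    self_mem_nhdsWithin : ∀ᶠ t : ℝ in 𝓝[<] 1, _).exists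
  have htζ : ‖(t : ℂ) * ζ‖ < 1 := by
    rw [norm_mul, hζ, mul_one, Complex.norm_real, Real.norm_of_nonneg ht0.le]
    exact htl
  have hnz : ∀ z ∈ Metric.closedBall a R, ev p (z, (t : ℂ) * ζ) ≠ 0 := fun z hz =>
    hp _ ⟨hball z hz, htζ⟩
  -- For `t < 1` near `1`, the function `p(·, t ζ)` has no zeros in the closed ball. Its modulus
  -- exceeds `δ / 2` on the circle and is below `δ / 2` at the centre, contradicting the maximum
  -- principle for the reciprocal.
  have hd : DiffContOnCl ℂ (fun z => (ev p (z, (t : ℂ) * ζ))⁻¹) (Metric.ball a R) := by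
    refine DifferentiableOn.diffContOnCl ?_
    rw [closure_ball a hR0.ne']
    refine DifferentiableOn.inv ?_ hnz
    exact ((differentiable_ev p).comp (differentiable_id.prodMk
      (differentiable_const _))).differentiableOn
  have h4 := Complex.norm_le_of_forall_mem_frontier_norm_le Metric.isBounded_ball hd
    (C := 2 / δ) (fun z hz => by
      rw [frontier_ball a hR0.ne'] at hz
      rw [norm_inv, inv_le_comm₀ (norm_pos_iff.2 (hnz z (Metric.sphere_subset_closedBall hz)))
        (by positivity), inv_div]
      exact (ht1 z hz).le) (subset_closure (Metric.mem_ball_self hR0))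
  rw [norm_inv, inv_le_comm₀ (norm_pos_iff.2 (hnz a (Metric.mem_closedBall_self hR0.le)))
        (by positivity), inv_div] at h4
  linarith

theorem eq_zero_of_slice {f : BiPoly} {s : Set ℂ} (hs : s.Infinite) (h : ∀ ζ ∈ s, slice f ζ = 0) :
    f = 0 := by
  ext1 k
  refine eq_of_infinite_eval_eq _ _ (hs.mono fun ζ hζ => ?_)
  have := congrArg (fun q => q.coeff k) (h ζ hζ)
  simpa [slice] using this

theorem ev_ext {f g : BiPoly} (h : ∀ z ∈ bidisk, ev f z = ev g z) : f = g := by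
  refine sub_eq_zero.1 (eq_zero_of_slice infinite_disk fun ζ hζ => eq_of_eval_disk fun z hz => ?_)
  have := h (z, ζ) ⟨hz, hζ⟩
  rw [← eval_slice, ← eval_slice] at this
  rw [slice, Polynomial.map_sub, eval_sub, eval_zero, sub_eq_zero]
  exact this

open Filter Topology in
theorem eq_zero_of_continuous_of_finite {g : ℂ → ℂ} (hg : Continuous g) {s : Set ℂ} (hs : s.Finite)
    (h : ∀ ζ : ℂ, ‖ζ‖ = 1 → ζ ∉ s → g ζ = 0) {u : ℂ} (hu : ‖u‖ = 1) : g u = 0 := by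
  have h1 := (isPreconnected_sphere (E := ℂ) (by simp [Complex.rank_real_complex]) 0 1)
  have h2 : (Metric.sphere (0 : ℂ) 1).Nontrivial := ⟨1, by simp, -1, by simp, by norm_num⟩
  have h3 := accPt_iff_frequently.1 (h1.preperfect_of_nontrivial h2 u (by simpa using hu))
  have h4 : ∀ᶠ y in 𝓝 u, y ∉ s \ {u} :=
    (hs.subset Set.sdiff_subset).isClosed.isOpen_compl.mem_nhds (by simp)
  refine (isClosed_singleton (x := (0 : ℂ)).preimage hg).mem_of_frequently_of_tendsto
    ((h3.and_eventually h4).mono fun y hy => ?_) tendsto_id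
  exact h y (by simpa using hy.1.2) fun hys => hy.2 ⟨hys, hy.1.1⟩

theorem finite_slice_eq_zero {f : BiPoly} (hf : f ≠ 0) : {ζ : ℂ | slice f ζ = 0}.Finite := by
  by_contra h
  exact hf (eq_zero_of_slice h fun ζ hζ => hζ)

/-- A continuous function that vanishes on the part of the torus where a nonzero polynomial does
not vanish, vanishes on the torus. -/
theorem eq_zero_of_continuous_of_torus {g : ℂ × ℂ → ℂ} (hg : Continuous g) {f : BiPoly} (hf : f ≠ 0)
    (h : ∀ z ∈ torus, ev f z ≠ 0 → g z = 0) {z : ℂ × ℂ} (hz : z ∈ torus) : g z = 0 := by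
  refine eq_zero_of_continuous_of_finite (g := fun ζ => g (z.1, ζ)) (by fun_prop)
    (finite_slice_eq_zero hf) (fun ζ hζ hζs => ?_) hz.2
  refine eq_zero_of_continuous_of_finite (g := fun x => g (x, ζ)) (by fun_prop)
    (Finset.finite_toSet (slice f ζ).roots.toFinset) (fun x hx hxs => ?_) hz.1
  refine h _ ⟨hx, hζ⟩ fun h0 => hxs ?_
  simp only [Finset.mem_coe, Multiset.mem_toFinset]
  rw [mem_roots hζs, IsRoot, eval_slice, h0]

theorem exists_torus_ne_zero {f : BiPoly} (hf : f ≠ 0) : ∃ z ∈ torus, ev f z ≠ 0 := by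
  by_contra! h
  exact one_ne_zero (eq_zero_of_continuous_of_torus (g := fun _ => 1) continuous_const hf
    (fun z hz hz' => absurd (h z hz) hz') (z := (1, 1)) ⟨by simp, by simp⟩)

variable {M N : ℕ} {S : ℂ × ℂ → Matrix (Fin M) (Fin N) ℂ} {p : BiPoly}
  {Q : Matrix (Fin M) (Fin N) BiPoly}

theorem IsLowestTerms.ne_zero' (h : IsLowestTerms S p Q) : p ≠ 0 := by
  rintro rfl
  exact h.ne_zero (0, 0) ⟨by simp, by simp⟩ (by simp [ev])

theorem ev_mul (f g : BiPoly) (z : ℂ × ℂ) : ev (f * g) z = ev f z * ev g z := by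
  simp only [ev, evalEval, eval_mul]

/-- The fraction in the hypothesis on `S` may differ from `Q / p`, but equality on the bidisk gives
`p' Q = p Q'` as polynomials. This transfers the identity to the points of the torus where `p' ≠ 0`,
and continuity covers the rest. -/
theorem IsLowestTerms.isometric (hS : IsRationalIsoInner S) (h : IsLowestTerms S p Q) {z : ℂ × ℂ}
    (hz : z ∈ torus) : (evM Q z)ᴴ * evM Q z = (conj (ev p z) * ev p z) • 1 := by
  obtain ⟨p', Q', h', hiso⟩ := hS
  have hmul : ∀ i j, p' * Q i j = p * Q' i j := fun i j => ev_ext fun w hw => by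
    have h1 := congrFun (congrFun ((h.eq_div w hw).symm.trans (h'.eq_div w hw)) i) j
    simp only [Matrix.smul_apply, smul_eq_mul, evM, Matrix.map_apply] at h1
    have := h.ne_zero w hw
    have := h'.ne_zero w hw
    rw [ev_mul, ev_mul]
    field_simp at h1
    rw [mul_comm, h1]
  have hmulM : ∀ w, ev p' w • evM Q w = ev p w • evM Q' w := fun w => by
    ext i j
    simp only [Matrix.smul_apply, smul_eq_mul, evM, Matrix.map_apply, ← ev_mul, hmul]
  ext i j
  have hcont : Continuous fun w => ((evM Q w)ᴴ * evM Q w) i j -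
      ((conj (ev p w) * ev p w) • (1 : Matrix (Fin N) (Fin N) ℂ)) i j := by
    simp only [Matrix.mul_apply, Matrix.conjTranspose_apply, evM, Matrix.map_apply,
      Matrix.smul_apply, smul_eq_mul]
    have := fun f => continuous_ev f
    have := Complex.continuous_conj
    fun_prop
  refine sub_eq_zero.1 (eq_zero_of_continuous_of_torus hcont h'.ne_zero' (fun w hw hw0 => ?_) hz)
  have h1 : evM Q w = ev p w • ((ev p' w)⁻¹ • evM Q' w) := by
    rw [smul_comm, ← hmulM, smul_smul, inv_mul_cancel₀ hw0, one_smul]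
  rw [h1, conjTranspose_smul, Matrix.smul_mul, Matrix.mul_smul, hiso w hw hw0, smul_smul]
  exact sub_self _

/-- At a point of the torus with `p ≠ 0` the matrix `Q` is injective. The inequality leaves room for
the constant isometry `V`. -/
theorem IsLowestTerms.card_le (hS : IsRationalIsoInner S) (h : IsLowestTerms S p Q) : N ≤ M := by
  obtain ⟨z, hz, hpz⟩ := exists_torus_ne_zero h.ne_zero'
  have h1 := h.isometric hS hz
  have h2 : Function.Injective (evM Q z).mulVecLin := by
    refine LinearMap.ker_eq_bot.1 (LinearMap.ker_eq_bot'.2 fun x hx => ?_)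
    have h3 : ((evM Q z)ᴴ * evM Q z) *ᵥ x = 0 := by
      rw [← Matrix.mulVec_mulVec]
      change _ *ᵥ ((evM Q z).mulVecLin x) = 0
      rw [hx, Matrix.mulVec_zero]
    rw [h1, Matrix.smul_mulVec, Matrix.one_mulVec] at h3
    exact (smul_eq_zero.1 h3).resolve_left (by simp [hpz])
  simpa using LinearMap.finrank_le_finrank_of_injective h2

end Bidisk

/-! ### The spectral factor `A`, and isometries from equal Gram matrices -/

namespace Bidisk

variable {M N : ℕ} {S : ℂ × ℂ → Matrix (Fin M) (Fin N) ℂ} {p : BiPoly}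
  {Q : Matrix (Fin M) (Fin N) BiPoly}

theorem lam_gram_apply {n : ℕ} (P : Matrix (Fin n × Fin N) (Fin n × Fin N) ℂ) (w z : ℂ)
    (i l : Fin N) : ((lam n N w)ᴴ * P * lam n N z) i l =
      ∑ j : Fin n, ∑ k : Fin n, P (j, i) (k, l) * (conj w ^ (j : ℕ) * z ^ (k : ℕ)) := by
  simp only [Matrix.mul_apply, Matrix.conjTranspose_apply, lam, Matrix.of_apply,
    Fintype.sum_prod_type, mul_ite, mul_zero, Finset.sum_ite_eq', Finset.mem_univ, if_true,
    apply_ite star, star_zero, ite_mul, zero_mul, Finset.sum_mul, star_pow, RCLike.star_def]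
  rw [Finset.sum_comm]
  exact Finset.sum_congr rfl fun j _ => Finset.sum_congr rfl fun k _ => by ring

theorem eq_zero_of_sum_pow {n : ℕ} {c : Fin n → ℂ} {s : Set ℂ} (hs : s.Infinite)
    (h : ∀ z ∈ s, ∑ k, c k * z ^ (k : ℕ) = 0) (k : Fin n) : c k = 0 := by
  have h0 : ∑ k, C (c k) * X ^ (k : ℕ) = (0 : ℂ[X]) :=
    eq_of_infinite_eval_eq _ _ (hs.mono fun z hz => by simpa [eval_finsetSum] using h z hz)
  have := congrArg (fun q => q.coeff (k : ℕ)) h0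
  simpa [finsetSum_coeff, coeff_X_pow, Fin.val_inj] using this

theorem eq_zero_of_lam {n : ℕ} {P : Matrix (Fin n × Fin N) (Fin n × Fin N) ℂ}
    (h : ∀ w z : ℂ, ‖w‖ < 1 → ‖z‖ < 1 → (lam n N w)ᴴ * P * lam n N z = 0) : P = 0 := by
  ext ⟨j, i⟩ ⟨k, l⟩
  refine eq_zero_of_sum_pow infinite_disk (c := fun k => P (j, i) (k, l)) (fun z hz => ?_) k
  refine eq_zero_of_sum_pow infinite_disk
    (c := fun j => ∑ k, P (j, i) (k, l) * z ^ (k : ℕ)) (fun w hw => ?_) j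
  have := congrFun (congrFun (h (conj w) z (by simpa using hw) hz) i) l
  rw [lam_gram_apply, Complex.conj_conj] at this
  rw [Matrix.zero_apply] at this
  rw [← this]
  refine Finset.sum_congr rfl fun j _ => ?_
  rw [Finset.sum_mul]
  exact Finset.sum_congr rfl fun k _ => by ring

theorem natDegree_le_degZ₁ : p.natDegree ≤ degZ₁ p Q := le_max_left _ _

theorem natDegree_entry_le_degZ₁ (i : Fin M) (j : Fin N) : (Q i j).natDegree ≤ degZ₁ p Q :=
  le_max_of_le_right ((Finset.le_sup (f := fun j => (Q i j).natDegree) (Finset.mem_univ j)).trans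
    (Finset.le_sup (f := fun i => Finset.univ.sup fun j => (Q i j).natDegree) (Finset.mem_univ i)))

theorem ev₁_toep {a n : Type*} (d : ℕ) (A : Matrix a n BiPoly) (ζ : ℂ) :
    ev₁ (toep d A) ζ = toep d (A.map fun f => slice f ζ) := by
  ext x y
  simp only [toep, ev₁_apply, Matrix.of_apply, Matrix.map_apply, slice, coeff_map,
    coe_evalRingHom]
  split_ifs <;> simp

theorem ev₁_slice {a n : Type*} (A : Matrix a n BiPoly) (z ζ : ℂ) :
    ev₁ (A.map fun f => slice f ζ) z = evM A (z, ζ) := by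
  ext
  simp [ev₁, evM, eval_slice]

theorem evM_smul_one (p : BiPoly) (z : ℂ × ℂ) :
    evM (p • (1 : Matrix (Fin N) (Fin N) BiPoly)) z = ev p z • 1 := by
  ext i j
  by_cases h : i = j <;> simp [evM, h, ev]

theorem defect_eq_gram (p : BiPoly) (Q : Matrix (Fin M) (Fin N) BiPoly) (w z : ℂ × ℂ) :
    defect p Q w z = (evM (p • (1 : Matrix (Fin N) (Fin N) BiPoly)) w)ᴴ *
      evM (p • (1 : Matrix (Fin N) (Fin N) BiPoly)) z - (evM Q w)ᴴ * evM Q z := by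
  rw [defect, evM_smul_one, evM_smul_one, conjTranspose_smul, conjTranspose_one, Matrix.smul_mul,
    Matrix.one_mul, smul_smul]
  rfl

/-- The matrix Fejér-Riesz factorization of the coefficient matrix of the defect. -/
theorem IsLowestTerms.exists_factor (hS : IsRationalIsoInner S) (h : IsLowestTerms S p Q) :
    ∃ (r : ℕ) (A : Matrix (Fin r) (Fin (degZ₁ p Q) × Fin N) ℂ[X]),
      (∀ ζ : ℂ, ‖ζ‖ = 1 → ∀ w₁ z₁ : ℂ, defect p Q (w₁, ζ) (z₁, ζ) = (1 - conj w₁ * z₁) •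
        ((lam (degZ₁ p Q) N w₁)ᴴ * ((ev₁ A ζ)ᴴ * ev₁ A ζ) * lam (degZ₁ p Q) N z₁)) ∧
      ∀ ζ : ℂ, ‖ζ‖ < 1 → ∃ B : Matrix (Fin (degZ₁ p Q) × Fin N) (Fin r) ℂ, ev₁ A ζ * B = 1 := by
  set n := degZ₁ p Q
  let P : Matrix (Fin N) (Fin N) BiPoly := p • 1
  -- The Bezoutian has `n + 1` block rows and columns, but the last ones vanish on the circle;
  -- dropping them leaves the size that matches `Λ`.
  let g : Fin n × Fin N → Fin (n + 1) × Fin N := Prod.map Fin.castSucc id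
  let Y := (toep (n + 1) P).submatrix id g
  let W := (toep (n + 1) Q).submatrix id g
  let Pζ : ℂ → Matrix (Fin N) (Fin N) ℂ[X] := fun ζ => P.map fun f => slice f ζ
  let Qζ : ℂ → Matrix (Fin M) (Fin N) ℂ[X] := fun ζ => Q.map fun f => slice f ζ
  have hiso : ∀ ζ, ‖ζ‖ = 1 → ∀ z, ‖z‖ = 1 →
      (ev₁ (Pζ ζ) z)ᴴ * ev₁ (Pζ ζ) z = (ev₁ (Qζ ζ) z)ᴴ * ev₁ (Qζ ζ) z := fun ζ hζ z hz => by
    rw [ev₁_slice, ev₁_slice, h.isometric hS (z := (z, ζ)) ⟨hz, hζ⟩, evM_smul_one,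
      conjTranspose_smul, conjTranspose_one, Matrix.smul_mul, Matrix.one_mul, smul_smul]
    rfl
  have hYW : ∀ ζ, (ev₁ Y ζ)ᴴ * ev₁ Y ζ - (ev₁ W ζ)ᴴ * ev₁ W ζ =
      (bez (n + 1) (Pζ ζ) (Qζ ζ)).submatrix g g := fun ζ => by
    rw [bez, ← ev₁_toep, ← ev₁_toep]
    rfl
  have hpsd : ∀ ζ : ℂ, ‖ζ‖ = 1 → (bez (n + 1) (Pζ ζ) (Qζ ζ)).PosSemidef := fun ζ hζ => by
    -- If the slice of `p` vanishes identically, the isometry relation makes that of `Q` vanish, and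
    -- the Bezoutian is zero. Otherwise `p(·, ζ) I` is invertible in the disk.
    rcases slice_eq_zero_or_ne_zero p h.ne_zero hζ with h0 | h0
    · have hp0 : ∀ z, evM P (z, ζ) = 0 := fun z => by
        rw [evM_smul_one, ← eval_slice, h0, eval_zero, zero_smul]
      have hP : Pζ ζ = 0 := by
        ext1 i j
        refine Polynomial.funext fun z => ?_
        have := congrFun (congrFun (hp0 z) i) j
        rw [← ev₁_slice] at this
        rw [Matrix.zero_apply, eval_zero]
        exact this
      have hQ : Qζ ζ = 0 := by
        ext1 i j
        refine eq_of_eval_circle fun z hz => ?_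
        have h1 := hiso ζ hζ z hz
        rw [ev₁_slice, hp0, conjTranspose_zero, Matrix.zero_mul, eq_comm,
          conjTranspose_mul_self_eq_zero] at h1
        simpa [ev₁_apply] using congrFun (congrFun h1 i) j
      have hz : ∀ a : ℕ, toep (n + 1) (0 : Matrix (Fin a) (Fin N) ℂ[X]) = 0 := fun a => by
        ext
        simp [toep]
      rw [bez, hP, hQ, hz, hz]
      simpa using PosSemidef.zero
    · refine bez_posSemidef n _ _ (hiso ζ hζ) fun z hz => ⟨(ev p (z, ζ))⁻¹ • 1, ?_⟩
      have := h0 z hz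
      rw [eval_slice] at this
      rw [ev₁_slice, evM_smul_one, Matrix.smul_mul, Matrix.one_mul, smul_smul,
        mul_inv_cancel₀ this, one_smul]
  obtain ⟨r, A, hA, hB⟩ := exists_outer_factor Y W fun ζ hζ => by
    rw [hYW]
    exact (hpsd ζ hζ).submatrix g
  refine ⟨r, A, fun ζ hζ w z => ?_, hB⟩
  have hdeg : ∀ i j, (Pζ ζ i j).natDegree ≤ n := fun i j => by
    refine natDegree_map_le.trans ?_
    by_cases hij : i = j
    · simpa [P, hij] using natDegree_le_degZ₁
    · simp [P, hij]
  have hdegQ : ∀ i j, (Qζ ζ i j).natDegree ≤ n := fun i j =>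
    natDegree_map_le.trans (natDegree_entry_le_degZ₁ i j)
  rw [hA ζ hζ, hYW]
  ext i l
  have h1 := gram_sub_gram_eq_bez n (Pζ ζ) (Qζ ζ) hdeg hdegQ (hiso ζ hζ) w z i l
  rw [ev₁_slice, ev₁_slice, ev₁_slice, ev₁_slice, ← defect_eq_gram] at h1
  rw [h1, Matrix.smul_apply, smul_eq_mul, lam_gram_apply]
  congr 1
  rw [Fin.sum_univ_castSucc]
  have h2 : ∀ k, bez (n + 1) (Pζ ζ) (Qζ ζ) (Fin.last n, i) (k, l) = 0 := fun k =>
    bez_last n _ _ hdeg hdegQ (hiso ζ hζ) k i l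
  have h3 : ∀ j, bez (n + 1) (Pζ ζ) (Qζ ζ) (j, i) (Fin.last n, l) = 0 := fun j =>
    bez_last' n _ _ hdeg hdegQ (hiso ζ hζ) j l i
  simp only [Fin.sum_univ_castSucc, h2, h3, zero_mul, Finset.sum_const_zero, add_zero]
  rfl

/-- Two families of vectors with the same Gram matrix are related by an isometry. -/
theorem exists_linearIsometry_of_inner_eq {I E F : Type*} [NormedAddCommGroup E]
    [InnerProductSpace ℂ E] [FiniteDimensional ℂ E] [NormedAddCommGroup F] [InnerProductSpace ℂ F]
    [FiniteDimensional ℂ F] (hc : Module.finrank ℂ E ≤ Module.finrank ℂ F) (f : I → E) (g : I → F)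
    (h : ∀ i j, inner ℂ (f i) (f j) = inner ℂ (g i) (g j)) :
    ∃ V : E →ₗᵢ[ℂ] F, ∀ i, V (f i) = g i := by
  let b := stdOrthonormalBasis ℂ E
  -- Embedding `E` in `F` reduces the claim to extending an isometry from a subspace of `F` to all
  -- of `F`.
  let J₀ : E →ₗ[ℂ] F := b.toBasis.constr ℂ fun i => stdOrthonormalBasis ℂ F (Fin.castLE hc i)
  let J : E →ₗᵢ[ℂ] F := J₀.isometryOfOrthonormal (v := b.toBasis) (by simp) (by
    have : J₀ ∘ b.toBasis = fun i => stdOrthonormalBasis ℂ F (Fin.castLE hc i) :=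
      funext fun i => b.toBasis.constr_basis ℂ _ i
    rw [this]
    exact (stdOrthonormalBasis ℂ F).orthonormal.comp _ (Fin.castLE_injective hc))
  let f' : (I →₀ ℂ) →ₗ[ℂ] F := Finsupp.linearCombination ℂ fun i => J (f i)
  let g' : (I →₀ ℂ) →ₗ[ℂ] F := Finsupp.linearCombination ℂ g
  have hin : ∀ x y, inner ℂ (f' x) (f' y) = inner ℂ (g' x) (g' y) := fun x y => by
    simp only [f', g', Finsupp.linearCombination_apply, Finsupp.sum, sum_inner, inner_sum,
      inner_smul_left, inner_smul_right, LinearIsometry.inner_map_map, h]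
  have hnorm : ∀ x, ‖g' x‖ = ‖f' x‖ := fun x => by
    rw [@norm_eq_sqrt_re_inner ℂ, @norm_eq_sqrt_re_inner ℂ _ _ _ _ (f' x), hin]
  have hbd : ∃ C : ℝ, ∀ x, ‖g' x‖ ≤ C * ‖f' x‖ := ⟨1, fun x => by rw [one_mul, hnorm]⟩
  have hval : ∀ x, g'.compLeftInverse f' ⟨f' x, x, rfl⟩ = g' x := fun x =>
    LinearMap.compLeftInverse_apply_of_bdd g' f' hbd x _ rfl
  let L : LinearMap.range f' →ₗᵢ[ℂ] F := ⟨(g'.compLeftInverse f').toLinearMap, by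
    rintro ⟨_, x, rfl⟩
    change ‖g'.compLeftInverse f' ⟨f' x, x, rfl⟩‖ = ‖f' x‖
    rw [hval, hnorm]⟩
  refine ⟨L.extend.comp J, fun i => ?_⟩
  have hi : f' (Finsupp.single i 1) = J (f i) := by simp [f']
  have h1 := L.extend_apply ⟨f' (Finsupp.single i 1), _, rfl⟩
  change L.extend (J (f i)) = g i
  rw [← hi]
  refine h1.trans ?_
  change g'.compLeftInverse f' ⟨f' (Finsupp.single i 1), _, rfl⟩ = g i
  rw [hval]
  simp [g']

theorem exists_isometric_matrix {I m n : Type*} [Fintype m] [Fintype n] [DecidableEq n]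
    (hc : Fintype.card n ≤ Fintype.card m) (f : I → n → ℂ) (g : I → m → ℂ)
    (h : ∀ i j, star (f i) ⬝ᵥ f j = star (g i) ⬝ᵥ g j) :
    ∃ V : Matrix m n ℂ, Vᴴ * V = 1 ∧ ∀ i, V *ᵥ f i = g i := by
  obtain ⟨V, hV⟩ := exists_linearIsometry_of_inner_eq (E := EuclideanSpace ℂ n)
    (F := EuclideanSpace ℂ m) (by simpa using hc) (fun i => WithLp.toLp 2 (f i))
    (fun i => WithLp.toLp 2 (g i)) fun i j => by
      simpa [EuclideanSpace.inner_eq_star_dotProduct, dotProduct_comm] using h i j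
  let A : Matrix m n ℂ := Matrix.toEuclideanLin.symm V.toLinearMap
  have hA : ∀ x, WithLp.toLp 2 (A *ᵥ x) = V (WithLp.toLp 2 x) := fun x => by
    have h1 : Matrix.toEuclideanLin A = V.toLinearMap := LinearEquiv.apply_symm_apply _ _
    rw [← LinearIsometry.coe_toLinearMap, ← h1]
    rfl
  refine ⟨A, ?_, fun i => WithLp.toLp_injective 2 ((hA _).trans (hV i))⟩
  refine Matrix.ext_of_mulVec_single fun j => funext fun i => ?_
  have h2 := V.inner_map_map (WithLp.toLp 2 (Pi.single i 1)) (WithLp.toLp 2 (Pi.single j 1))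
  rw [← hA, ← hA] at h2
  simp only [EuclideanSpace.inner_eq_star_dotProduct, dotProduct_comm _ (star _)] at h2
  rw [Matrix.star_mulVec, ← Matrix.dotProduct_mulVec, Matrix.mulVec_mulVec] at h2
  simpa [Pi.single_apply, Matrix.one_apply, eq_comm] using h2

end Bidisk

/-! ### Polynomial kernels and the block matrices of the construction -/

namespace Bidisk

variable {M N : ℕ}

/-- The identity theorem is applied in one variable, on the complex line through `0` and `z`. -/
theorem eq_zero_of_eqOn_bidisk {g : ℂ × ℂ → ℂ} (hg : Differentiable ℂ g)
    (h : ∀ z ∈ bidisk, g z = 0) (z : ℂ × ℂ) : g z = 0 := by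
  have hc : Differentiable ℂ fun t : ℂ => g (t * z.1, t * z.2) := by fun_prop
  have hev : (fun t : ℂ => g (t * z.1, t * z.2)) =ᶠ[nhds 0] 0 := by
    have h1 : ∀ᶠ t : ℂ in nhds 0, ‖t * z.1‖ < 1 :=
      Filter.Tendsto.eventually_lt_const (v := 0) zero_lt_one
        (Continuous.tendsto' (by fun_prop) _ _ (by simp))
    have h2 : ∀ᶠ t : ℂ in nhds 0, ‖t * z.2‖ < 1 :=
      Filter.Tendsto.eventually_lt_const (v := 0) zero_lt_one
        (Continuous.tendsto' (by fun_prop) _ _ (by simp))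
    filter_upwards [h1, h2] with t ht1 ht2
    exact h _ ⟨ht1, ht2⟩
  have := AnalyticOnNhd.eqOn_zero_of_preconnected_of_eventuallyEq_zero
    (U := Set.univ) (fun t _ => hc.analyticAt t) isPreconnected_univ (Set.mem_univ 0) hev
    (Set.mem_univ 1)
  simpa using this

/-- Hermitian kernels that are holomorphic in the second variable and vanish on the bidisk vanish
identically. -/
theorem kernel_eq_zero {D : ℂ × ℂ → ℂ × ℂ → Matrix (Fin N) (Fin N) ℂ}
    (hsymm : ∀ w z, (D w z)ᴴ = D z w) (hd : ∀ w i l, Differentiable ℂ fun z => D w z i l)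
    (h : ∀ w ∈ bidisk, ∀ z ∈ bidisk, D w z = 0) (w z : ℂ × ℂ) : D w z = 0 := by
  have h1 : ∀ w ∈ bidisk, ∀ z, D w z = 0 := fun w hw z => by
    ext i l
    exact eq_zero_of_eqOn_bidisk (hd w i l) (fun z hz => by rw [h w hw z hz]; rfl) z
  ext i l
  refine eq_zero_of_eqOn_bidisk (hd w i l) (fun z hz => ?_) z
  rw [← hsymm, h1 z hz, conjTranspose_zero]
  rfl

theorem differentiable_gram {k : ℕ} (Γ : Matrix (Fin k) (Fin N) BiPoly) (w : ℂ × ℂ) (i l : Fin N) :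
    Differentiable ℂ fun z => gram Γ w z i l := by
  simp only [gram, Matrix.mul_apply, evM, Matrix.map_apply]
  have := fun f => differentiable_ev f
  fun_prop

theorem conjTranspose_gram {k : ℕ} (Γ : Matrix (Fin k) (Fin N) BiPoly) (w z : ℂ × ℂ) :
    (gram Γ w z)ᴴ = gram Γ z w := by
  rw [gram, conjTranspose_mul, conjTranspose_conjTranspose, gram]

theorem conjTranspose_defect (p : BiPoly) (Q : Matrix (Fin M) (Fin N) BiPoly) (w z : ℂ × ℂ) :
    (defect p Q w z)ᴴ = defect p Q z w := by
  simp only [defect, conjTranspose_sub, conjTranspose_smul, conjTranspose_one, conjTranspose_mul,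
    conjTranspose_conjTranspose, star_mul', RCLike.star_def, Complex.conj_conj]
  rw [mul_comm]

theorem differentiable_defect (p : BiPoly) (Q : Matrix (Fin M) (Fin N) BiPoly) (w : ℂ × ℂ)
    (i l : Fin N) : Differentiable ℂ fun z => defect p Q w z i l := by
  have h : (fun z => defect p Q w z i l) = fun z =>
      conj (ev p w) * (1 : Matrix (Fin N) (Fin N) ℂ) i l * ev p z - gram Q w z i l := by
    ext z
    rw [defect, Matrix.sub_apply, Matrix.smul_apply, smul_eq_mul, gram]
    ring
  rw [h]
  exact ((differentiable_ev p).const_mul _).sub (differentiable_gram Q w i l)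

theorem mul_lam_apply {a : Type*} {n : ℕ} (P : Matrix a (Fin n × Fin N) ℂ) (z : ℂ) (i : a)
    (j : Fin N) : (P * lam n N z) i j = ∑ k : Fin n, P i (k, j) * z ^ (k : ℕ) := by
  simp [Matrix.mul_apply, lam, Fintype.sum_prod_type]

theorem evM_timesLam {r n : ℕ} (A : Matrix (Fin r) (Fin n × Fin N) ℂ[X]) (z : ℂ × ℂ) :
    evM (timesLam A) z = ev₁ A z.2 * lam n N z.1 := by
  ext i j
  rw [mul_lam_apply]
  simp [evM, timesLam, ev, evalEval, eval_finsetSum, ev₁_apply]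

theorem gram_timesLam {r n : ℕ} (A : Matrix (Fin r) (Fin n × Fin N) ℂ[X]) (w z : ℂ × ℂ) :
    gram (timesLam A) w z =
      (lam n N w.1)ᴴ * ((ev₁ A w.2)ᴴ * ev₁ A z.2) * lam n N z.1 := by
  simp only [gram, evM_timesLam, conjTranspose_mul, Matrix.mul_assoc]

theorem isPSDKernel_gram {k : ℕ} (Γ : Matrix (Fin k) (Fin N) BiPoly) : IsPSDKernel (gram Γ) := by
  intro n x v
  have : ∑ i, ∑ j, star (v i) ⬝ᵥ (gram Γ (x i) (x j) *ᵥ v j) =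
      star (∑ i, evM Γ (x i) *ᵥ v i) ⬝ᵥ ∑ i, evM Γ (x i) *ᵥ v i := by
    rw [star_sum, sum_dotProduct]
    refine Finset.sum_congr rfl fun i _ => ?_
    rw [dotProduct_sum]
    refine Finset.sum_congr rfl fun j _ => ?_
    rw [gram, ← Matrix.mulVec_mulVec, Matrix.dotProduct_mulVec, Matrix.star_mulVec]
  rw [this]
  exact dotProduct_star_self_nonneg _

/-- Transport of a polynomial in `(z₁, z₂)` to a polynomial in four variables. -/
def toMv (σ : ℂ →+* ℂ) (x y : Fin 4) (f : BiPoly) : MvPolynomial (Fin 4) ℂ :=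
  f.eval₂ (eval₂RingHom (MvPolynomial.C.comp σ) (MvPolynomial.X y)) (MvPolynomial.X x)

theorem eval_toMv (σ : ℂ →+* ℂ) (x y : Fin 4) (f : BiPoly) (v : Fin 4 → ℂ) (w : ℂ × ℂ)
    (hx : v x = σ w.1) (hy : v y = σ w.2) : MvPolynomial.eval v (toMv σ x y f) = σ (ev f w) := by
  rw [← Prod.mk.eta (p := w), ← eval_slice, slice, eval_map, hom_eval₂, toMv, hom_eval₂,
    MvPolynomial.eval_X, hx]
  congr 1
  refine Polynomial.ringHom_ext (fun a => ?_) ?_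
  · simp
  · simp [hy]

theorem isPolynomialKernel_gram {k : ℕ} (Γ : Matrix (Fin k) (Fin N) BiPoly) :
    IsPolynomialKernel (gram Γ) := by
  refine ⟨Matrix.of fun i l => ∑ a, toMv (starRingEnd ℂ) 0 1 (Γ a i) *
    toMv (RingHom.id ℂ) 2 3 (Γ a l), fun w z => ?_⟩
  ext i l
  simp only [gram, Matrix.mul_apply, Matrix.conjTranspose_apply, evM, Matrix.map_apply,
    Matrix.of_apply, map_sum, map_mul]
  refine Finset.sum_congr rfl fun a _ => ?_
  rw [eval_toMv (starRingEnd ℂ) 0 1 _ _ w rfl rfl, eval_toMv (RingHom.id ℂ) 2 3 _ _ z rfl rfl]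
  rfl

/-- The block matrix with block rows `(p₀ I, …, pₙ I)` and `(0, A)`. -/
def denomMatrix {n r : ℕ} (p : BiPoly) (A : Matrix (Fin r) (Fin n × Fin N) ℂ[X]) :
    Matrix (Fin N ⊕ Fin r) (Fin (n + 1) × Fin N) ℂ[X] :=
  Matrix.fromRows
    (Matrix.of fun i x => if x.2 = i then p.coeff (x.1 : ℕ) else 0)
    (Matrix.of fun a x => Fin.cases (motive := fun _ => ℂ[X]) 0 (fun k => A a (k, x.2)) x.1)

/-- The block matrix with block rows `(Q₀, …, Qₙ)` and `(A, 0)`. -/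
def numMatrix {n r : ℕ} (Q : Matrix (Fin M) (Fin N) BiPoly)
    (A : Matrix (Fin r) (Fin n × Fin N) ℂ[X]) :
    Matrix (Fin M ⊕ Fin r) (Fin (n + 1) × Fin N) ℂ[X] :=
  Matrix.fromRows
    (Matrix.of fun i x => (Q i x.2).coeff (x.1 : ℕ))
    (Matrix.of fun a x => Fin.lastCases (motive := fun _ => ℂ[X]) 0 (fun k => A a (k, x.2)) x.1)

theorem ev₁_numMatrix {n r : ℕ} (Q : Matrix (Fin M) (Fin N) BiPoly)
    (A : Matrix (Fin r) (Fin n × Fin N) ℂ[X]) (ζ : ℂ) :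
    ev₁ (numMatrix Q A) ζ = targetMatrix Q A ζ := by
  ext (i | a) ⟨k, j⟩
  · rfl
  · refine Fin.lastCases ?_ (fun k => ?_) k <;> simp [ev₁, numMatrix, targetMatrix]

theorem ev_eq_sum_fin (p : BiPoly) {n : ℕ} (hp : p.natDegree ≤ n) (z : ℂ × ℂ) :
    ev p z = ∑ k : Fin (n + 1), (p.coeff k).eval z.2 * z.1 ^ (k : ℕ) := by
  rw [ev_eq_sum p (Nat.lt_succ_of_le hp),
    Fin.sum_univ_eq_sum_range (fun k : ℕ => (p.coeff k).eval z.2 * z.1 ^ k)]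

theorem denomMatrix_mul_lam {n r : ℕ} {p : BiPoly} (hp : p.natDegree ≤ n)
    (A : Matrix (Fin r) (Fin n × Fin N) ℂ[X]) (z : ℂ × ℂ) :
    ev₁ (denomMatrix p A) z.2 * lam (n + 1) N z.1 =
      Matrix.fromRows (ev p z • (1 : Matrix (Fin N) (Fin N) ℂ)) (z.1 • evM (timesLam A) z) := by
  ext (i | a) j
  · rw [mul_lam_apply]
    simp only [ev₁_apply, denomMatrix, Matrix.fromRows_apply_inl, Matrix.of_apply,
      Matrix.smul_apply, Matrix.one_apply, smul_eq_mul, ev_eq_sum_fin p hp]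
    by_cases h : j = i
    · simp [h]
    · simp [h, Ne.symm h]
  · rw [mul_lam_apply, Fin.sum_univ_succ]
    simp only [ev₁_apply, denomMatrix, Matrix.fromRows_apply_inr, Matrix.of_apply,
      Fin.cases_zero, Fin.cases_succ, eval_zero, zero_mul, zero_add, Matrix.smul_apply,
      evM_timesLam, mul_lam_apply, smul_eq_mul, Finset.mul_sum, Fin.val_succ]
    exact Finset.sum_congr rfl fun k _ => by ring

theorem targetMatrix_mul_lam {n r : ℕ} {Q : Matrix (Fin M) (Fin N) BiPoly}
    (hQ : ∀ i j, (Q i j).natDegree ≤ n) (A : Matrix (Fin r) (Fin n × Fin N) ℂ[X]) (z : ℂ × ℂ) :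
    targetMatrix Q A z.2 * lam (n + 1) N z.1 =
      Matrix.fromRows (evM Q z) (evM (timesLam A) z) := by
  ext (i | a) j
  · rw [mul_lam_apply]
    simp only [targetMatrix, Matrix.fromRows_apply_inl, Matrix.of_apply, evM, Matrix.map_apply,
      ev_eq_sum_fin _ (hQ i j)]
  · rw [mul_lam_apply, Fin.sum_univ_castSucc]
    simp [targetMatrix, evM_timesLam, mul_lam_apply, ev₁_apply]

theorem denomMatrix_mul_rightInverse {n r : ℕ} {p : BiPoly}
    (A : Matrix (Fin r) (Fin n × Fin N) ℂ[X]) (B : ℂ → Matrix (Fin n × Fin N) (Fin r) ℂ) {ζ : ℂ}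
    (hp : (p.coeff 0).eval ζ ≠ 0) (hAB : ev₁ A ζ * B ζ = 1) :
    ev₁ (denomMatrix p A) ζ * rightInverse p B ζ = 1 := by
  ext (i | a) (j | c)
  · simp only [Matrix.mul_apply, Fintype.sum_prod_type, Fin.sum_univ_succ, ev₁_apply, denomMatrix,
      rightInverse, Matrix.fromRows_apply_inl, Matrix.fromCols_apply_inl, Matrix.of_apply,
      apply_ite (eval ζ), eval_zero, ite_mul, zero_mul, Finset.sum_ite_eq', Finset.mem_univ,
      if_true, Fin.succ_ne_zero, false_and, if_false, mul_zero, Finset.sum_const_zero, add_zero,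
      true_and, Fin.val_zero]
    by_cases h : i = j <;> simp [h, hp, Matrix.one_apply]
  · simp only [Matrix.mul_apply, Fintype.sum_prod_type, Fin.sum_univ_succ, ev₁_apply, denomMatrix,
      rightInverse, Matrix.fromRows_apply_inl, Matrix.fromCols_apply_inr, Matrix.of_apply,
      apply_ite (eval ζ), eval_zero, ite_mul, zero_mul, Finset.sum_ite_eq', Finset.mem_univ,
      if_true, Fin.val_zero, Fin.val_succ, Fin.cases_zero, Fin.cases_succ]
    rw [← mul_assoc, mul_neg, mul_inv_cancel₀ hp]
    simp
  · simp [Matrix.mul_apply, Fintype.sum_prod_type, Fin.sum_univ_succ, ev₁_apply, denomMatrix,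
      rightInverse]
  · have := congrFun (congrFun hAB a) c
    simp only [Matrix.mul_apply, Fintype.sum_prod_type, ev₁_apply] at this
    simpa [Matrix.mul_apply, Fintype.sum_prod_type, Fin.sum_univ_succ, ev₁_apply, denomMatrix,
      rightInverse, Matrix.one_apply] using this

end Bidisk

/-! ### Existence of the construction and the decomposition -/

namespace Bidisk

variable {M N : ℕ}

theorem conjTranspose_fromRows_mul_fromRows {m₁ m₂ n n' : Type*} [Fintype m₁] [Fintype m₂]
    (A : Matrix m₁ n ℂ) (B : Matrix m₂ n ℂ) (C : Matrix m₁ n' ℂ) (D : Matrix m₂ n' ℂ) :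
    (fromRows A B)ᴴ * fromRows C D = Aᴴ * C + Bᴴ * D := by
  rw [conjTranspose_fromRows_eq_fromCols_conjTranspose, fromCols_mul_fromRows]

/-- The defect identity in terms of the block columns `(p I, z₁ G)` and `(Q, G)`. -/
theorem gram_fromRows_sub {r : ℕ} (p : BiPoly) (Q : Matrix (Fin M) (Fin N) BiPoly)
    (G : Matrix (Fin r) (Fin N) BiPoly) (w z : ℂ × ℂ) :
    (fromRows (ev p w • (1 : Matrix (Fin N) (Fin N) ℂ)) (w.1 • evM G w))ᴴ *
        fromRows (ev p z • (1 : Matrix (Fin N) (Fin N) ℂ)) (z.1 • evM G z) -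
      (fromRows (evM Q w) (evM G w))ᴴ * fromRows (evM Q z) (evM G z) =
      defect p Q w z - (1 - conj w.1 * z.1) • gram G w z := by
  simp only [conjTranspose_fromRows_mul_fromRows, conjTranspose_smul, conjTranspose_one,
    Matrix.smul_mul, Matrix.mul_smul, Matrix.one_mul, smul_smul, defect, gram, RCLike.star_def]
  rw [sub_smul, one_smul, mul_comm z.1, mul_comm (ev p z)]
  abel

theorem one_sub_ne_zero {w z : ℂ} (hw : ‖w‖ < 1) (hz : ‖z‖ < 1) : 1 - conj w * z ≠ 0 := by
  intro h
  have h1 : ‖conj w * z‖ = 1 := by rw [← sub_eq_zero.1 h, norm_one]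
  rw [norm_mul, RCLike.norm_conj] at h1
  nlinarith [norm_nonneg w, norm_nonneg z]

/-- The positive kernel that gives the sub-dominant term. -/
theorem exists_subdominant {n r : ℕ} {p : BiPoly} {Q : Matrix (Fin M) (Fin N) BiPoly}
    (hp : p.natDegree ≤ n) (hQ : ∀ i j, (Q i j).natDegree ≤ n)
    (hp0 : ∀ ζ : ℂ, ‖ζ‖ < 1 → (p.coeff 0).eval ζ ≠ 0) (A : Matrix (Fin r) (Fin n × Fin N) ℂ[X])
    (hA : ∀ ζ : ℂ, ‖ζ‖ = 1 → ∀ w₁ z₁ : ℂ, defect p Q (w₁, ζ) (z₁, ζ) = (1 - conj w₁ * z₁) •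
      ((lam n N w₁)ᴴ * ((ev₁ A ζ)ᴴ * ev₁ A ζ) * lam n N z₁))
    (hB : ∀ ζ : ℂ, ‖ζ‖ < 1 → ∃ B : Matrix (Fin n × Fin N) (Fin r) ℂ, ev₁ A ζ * B = 1) :
    ∃ (s : ℕ) (L : Matrix (Fin s) (Fin (n + 1) × Fin N) ℂ[X]), ∀ w z : ℂ,
      (ev₁ (denomMatrix p A) w)ᴴ * ev₁ (denomMatrix p A) z -
        (targetMatrix Q A w)ᴴ * targetMatrix Q A z =
      (1 - conj w * z) • ((ev₁ L w)ᴴ * ev₁ L z) := by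
  simp only [← ev₁_numMatrix]
  refine exists_gram_of_isometric _ _ (fun ζ hζ => ?_) fun ζ hζ => ?_
  · refine sub_eq_zero.1 (eq_zero_of_lam fun w z _ _ => ?_)
    have h1 := denomMatrix_mul_lam hp A (w, ζ)
    have h2 := denomMatrix_mul_lam hp A (z, ζ)
    have h3 := targetMatrix_mul_lam hQ A (w, ζ)
    have h4 := targetMatrix_mul_lam hQ A (z, ζ)
    have h5 := gram_fromRows_sub p Q (timesLam A) (w, ζ) (z, ζ)
    rw [← h1, ← h2, ← h3, ← h4, hA ζ hζ, gram_timesLam, sub_self] at h5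
    rw [← h5, ev₁_numMatrix]
    simp only [Matrix.mul_sub, Matrix.sub_mul, conjTranspose_mul, Matrix.mul_assoc]
  · obtain ⟨B, hB⟩ := hB ζ hζ
    exact ⟨_, denomMatrix_mul_rightInverse A (fun _ => B) (hp0 ζ hζ) hB⟩

/-- If `T* T - T'* T' = c L* L` with `c > 0`, then `T'` and `L` factor through `T`. -/
theorem mul_rightInverse_mul {a a' l n : Type*} [Fintype a] [DecidableEq a] [Fintype a'] [Fintype l]
    [Fintype n] [DecidableEq n] {T : Matrix a n ℂ} {T' : Matrix a' n ℂ} {L : Matrix l n ℂ} {c : ℝ}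
    (hc : 0 < c) (h : Tᴴ * T - T'ᴴ * T' = (c : ℂ) • (Lᴴ * L)) {R : Matrix n a ℂ} (hR : T * R = 1) :
    T' * R * T = T' ∧ L * R * T = L := by
  -- Since `T Z = 0`, compressing the hypothesis by `Z` gives `(T' Z)* (T' Z) + c (L Z)* (L Z) = 0`,
  -- so both products vanish.
  set Z := R * T - 1
  have hZ : T * Z = 0 := by
    rw [Matrix.mul_sub, ← Matrix.mul_assoc, hR, Matrix.one_mul, Matrix.mul_one, sub_self]
  have hs : (√c : ℂ) * √c = c := by rw [← Complex.ofReal_mul, Real.mul_self_sqrt hc.le]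
  have h1 : (fromRows (T' * Z) ((√c : ℂ) • (L * Z)))ᴴ *
      fromRows (T' * Z) ((√c : ℂ) • (L * Z)) = 0 := by
    have h2 : Zᴴ * (Tᴴ * T - T'ᴴ * T') * Z = Zᴴ * ((c : ℂ) • (Lᴴ * L)) * Z := by rw [h]
    rw [conjTranspose_fromRows_mul_fromRows, conjTranspose_smul, Matrix.smul_mul, Matrix.mul_smul,
      smul_smul, RCLike.star_def, Complex.conj_ofReal, hs]
    simp only [Matrix.mul_sub, Matrix.sub_mul, Matrix.mul_smul, Matrix.smul_mul] at h2
    rw [Matrix.mul_assoc Zᴴ (Tᴴ * T), Matrix.mul_assoc Tᴴ, hZ, Matrix.mul_zero, Matrix.mul_zero,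
      zero_sub] at h2
    simp only [conjTranspose_mul, Matrix.mul_assoc] at h2 ⊢
    rw [← h2, add_neg_cancel]
  rw [conjTranspose_mul_self_eq_zero] at h1
  have h3 : T' * Z = 0 := by
    ext i j
    exact congrFun (congrFun h1 (Sum.inl i)) j
  have h4 : L * Z = 0 := by
    ext i j
    have := congrFun (congrFun h1 (Sum.inr i)) j
    simp only [fromRows_apply_inr, Matrix.smul_apply, smul_eq_mul, Matrix.zero_apply] at this
    refine (mul_eq_zero.1 this).resolve_left ?_
    exact_mod_cast (Real.sqrt_pos.2 hc).ne'
  rw [Matrix.mul_sub, Matrix.mul_one, sub_eq_zero, ← Matrix.mul_assoc] at h3 h4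
  exact ⟨h3, h4⟩

theorem one_sub_conj_mul_self {ζ : ℂ} (hζ : ‖ζ‖ < 1) :
    ∃ c : ℝ, 0 < c ∧ 1 - conj ζ * ζ = (c : ℂ) :=
  ⟨1 - ‖ζ‖ ^ 2, by nlinarith [norm_nonneg ζ], by rw [Complex.conj_mul']; push_cast; rfl⟩

theorem IsLowestTerms.coeff_zero_ne_zero {S : ℂ × ℂ → Matrix (Fin M) (Fin N) ℂ} {p : BiPoly}
    {Q : Matrix (Fin M) (Fin N) BiPoly} (h : IsLowestTerms S p Q) {ζ : ℂ} (hζ : ‖ζ‖ < 1) :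
    (p.coeff 0).eval ζ ≠ 0 := by
  have := h.ne_zero (0, ζ) ⟨by simp, hζ⟩
  rwa [ev_eq_sum_fin p le_rfl, Fin.sum_univ_succ, Fin.val_zero, pow_zero, mul_one,
    Finset.sum_eq_zero (fun k _ => by simp), add_zero] at this

/-- The construction can be carried out. -/
theorem nonempty_kummertConstruction {S : ℂ × ℂ → Matrix (Fin M) (Fin N) ℂ} {p : BiPoly}
    {Q : Matrix (Fin M) (Fin N) BiPoly} (hS : IsRationalIsoInner S) (h : IsLowestTerms S p Q) :
    Nonempty (KummertConstruction p Q) := by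
  obtain ⟨r, A, hA, hB⟩ := h.exists_factor hS
  have hp0 := fun ζ hζ => h.coeff_zero_ne_zero (ζ := ζ) hζ
  obtain ⟨s, L, hL⟩ := exists_subdominant natDegree_le_degZ₁ natDegree_entry_le_degZ₁ hp0 A hA hB
  obtain ⟨b, B', hb, hAB'⟩ := exists_rational_rightInverse A hB
  have hAB : ∀ ζ : ℂ, ‖ζ‖ < 1 → ev₁ A ζ * ((b.eval ζ)⁻¹ • ev₁ B' ζ) = 1 := fun ζ hζ => by
    have h1 : ev₁ (b • (1 : Matrix (Fin r) (Fin r) ℂ[X])) ζ = b.eval ζ • 1 := by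
      ext i j
      by_cases hij : i = j <;> simp [ev₁, hij]
    rw [Matrix.mul_smul, ← ev₁_mul, hAB', h1, smul_smul, inv_mul_cancel₀ (hb ζ hζ), one_smul]
  let R : ℂ → Matrix (Fin (degZ₁ p Q + 1) × Fin N) (Fin N ⊕ Fin r) ℂ :=
    rightInverse p fun ζ => (b.eval ζ)⁻¹ • ev₁ B' ζ
  have hR : ∀ ζ : ℂ, ‖ζ‖ < 1 → ev₁ (denomMatrix p A) ζ * R ζ = 1 := fun ζ hζ =>
    denomMatrix_mul_rightInverse A _ (hp0 ζ hζ) (hAB ζ hζ)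
  let F : ℂ → Matrix (Fin s) (Fin N ⊕ Fin r) ℂ := fun ζ => ev₁ L ζ * R ζ
  let U : ℂ → Matrix (Fin M ⊕ Fin r) (Fin N ⊕ Fin r) ℂ := fun ζ => targetMatrix Q A ζ * R ζ
  -- Compressing the identity for `L` by the right inverses `R(w)` and `R(z)` turns `T* T` into `1`.
  -- After rearrangement this is the equality of Gram matrices needed for `V`.
  have hgram : ∀ w z : ℂ, ‖w‖ < 1 → ‖z‖ < 1 →
      (fromRows (1 : Matrix (Fin N ⊕ Fin r) (Fin N ⊕ Fin r) ℂ) (w • F w))ᴴ *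
          fromRows (1 : Matrix (Fin N ⊕ Fin r) (Fin N ⊕ Fin r) ℂ) (z • F z) =
        (fromRows (U w) (F w))ᴴ * fromRows (U z) (F z) := fun w z hw hz => by
    have h1 : (R w)ᴴ * ((ev₁ (denomMatrix p A) w)ᴴ * ev₁ (denomMatrix p A) z -
        (targetMatrix Q A w)ᴴ * targetMatrix Q A z) * R z =
        (R w)ᴴ * ((1 - conj w * z) • ((ev₁ L w)ᴴ * ev₁ L z)) * R z := by rw [hL]
    have h2 : (R w)ᴴ * ((ev₁ (denomMatrix p A) w)ᴴ * ev₁ (denomMatrix p A) z) * R z = 1 := by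
      have := congrArg₂ (fun X Y => Xᴴ * Y) (hR w hw) (hR z hz)
      simpa only [conjTranspose_mul, Matrix.mul_assoc, conjTranspose_one, Matrix.one_mul] using this
    rw [Matrix.mul_sub, Matrix.sub_mul, h2, sub_smul, one_smul, Matrix.mul_sub, Matrix.sub_mul,
      Matrix.mul_smul, Matrix.smul_mul, sub_eq_sub_iff_add_eq_add] at h1
    simp only [conjTranspose_fromRows_mul_fromRows, conjTranspose_one, Matrix.one_mul,
      conjTranspose_smul, Matrix.smul_mul, Matrix.mul_smul, smul_smul, F, U, conjTranspose_mul,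
      RCLike.star_def, Matrix.mul_assoc] at h1 ⊢
    rw [mul_comm z, h1, add_comm]
  obtain ⟨V, hV, hVF⟩ := exists_isometric_matrix
    (I := {ζ : ℂ // ‖ζ‖ < 1} × (Fin N ⊕ Fin r)) (m := (Fin M ⊕ Fin r) ⊕ Fin s)
    (n := (Fin N ⊕ Fin r) ⊕ Fin s) (by simpa using h.card_le hS)
    (fun x y => fromRows (1 : Matrix (Fin N ⊕ Fin r) (Fin N ⊕ Fin r) ℂ) (x.1.1 • F x.1.1) y x.2)
    (fun x y => fromRows (U x.1.1) (F x.1.1) y x.2) fun x y =>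
      congrFun (congrFun (hgram x.1 y.1 x.1.2 y.1.2) x.2) y.2
  refine ⟨⟨r, A, hA, b, B', hb, hAB, s, V, F, hV, fun ζ hζ => ?_, timesLam L, fun z hz => ?_⟩⟩
  · ext y x
    exact congrFun (hVF (⟨ζ, hζ⟩, x)) y
  · obtain ⟨c, hc, hc'⟩ := one_sub_conj_mul_self hz.2
    -- `F T = L R T = L`, so `L Λ` is a polynomial formula for `H`.
    have h1 := (mul_rightInverse_mul hc (by rw [← hc']; exact hL z.2 z.2) (hR z.2 hz.2)).2
    rw [← denomMatrix_mul_lam natDegree_le_degZ₁, evM_timesLam, ← Matrix.mul_assoc, h1]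

namespace KummertConstruction

variable {S : ℂ × ℂ → Matrix (Fin M) (Fin N) ℂ} {p : BiPoly} {Q : Matrix (Fin M) (Fin N) BiPoly}

theorem exists_rightInverse_A (𝒦 : KummertConstruction p Q) (ζ : ℂ) (hζ : ‖ζ‖ < 1) :
    ∃ B : Matrix (Fin (degZ₁ p Q) × Fin N) (Fin 𝒦.r) ℂ, ev₁ 𝒦.A ζ * B = 1 :=
  ⟨_, 𝒦.A_mul_B ζ hζ⟩

/-- The constant isometric matrix maps `(p I, z₁ G, z₂ H)` to `(Q, G, H)`. -/
theorem V_mul (𝒦 : KummertConstruction p Q) (h : IsLowestTerms S p Q) {z : ℂ × ℂ}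
    (hz : z ∈ bidisk) :
    𝒦.V * fromRows (fromRows (ev p z • (1 : Matrix (Fin N) (Fin N) ℂ)) (z.1 • evM 𝒦.G z))
        (z.2 • evM 𝒦.H z) =
      fromRows (fromRows (evM Q z) (evM 𝒦.G z)) (evM 𝒦.H z) := by
  have hp0 := fun ζ hζ => h.coeff_zero_ne_zero (ζ := ζ) hζ
  -- This `L` need not be related to the given `F`; it only supplies the positivity that yields `U T
  -- = T'`.
  obtain ⟨s, L, hL⟩ := exists_subdominant natDegree_le_degZ₁ natDegree_entry_le_degZ₁ hp0 𝒦.A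
    𝒦.factor 𝒦.exists_rightInverse_A
  obtain ⟨c, hc, hc'⟩ := one_sub_conj_mul_self hz.2
  have hR := denomMatrix_mul_rightInverse 𝒦.A
    (fun ζ => (𝒦.b.eval ζ)⁻¹ • ev₁ 𝒦.B' ζ) (hp0 z.2 hz.2) (𝒦.A_mul_B z.2 hz.2)
  have h1 := (mul_rightInverse_mul hc (by rw [← hc']; exact hL z.2 z.2) hR).1
  have hreal : 𝒦.V * fromRows (1 : Matrix (Fin N ⊕ Fin 𝒦.r) (Fin N ⊕ Fin 𝒦.r) ℂ) (z.2 • 𝒦.F z.2) = _ :=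
    𝒦.realization z.2 hz.2
  have h2 := congrArg (fun Y => Y * fromRows (ev p z • (1 : Matrix (Fin N) (Fin N) ℂ))
    (z.1 • evM (timesLam 𝒦.A) z)) hreal
  simp only [Matrix.mul_assoc, fromRows_mul, Matrix.one_mul, Matrix.smul_mul,
    ← 𝒦.H_eq z hz] at h2
  refine h2.trans ?_
  rw [G, ← targetMatrix_mul_lam natDegree_entry_le_degZ₁, ← denomMatrix_mul_lam natDegree_le_degZ₁,
    ← Matrix.mul_assoc, ← Matrix.mul_assoc, h1]

/-- The isometry `V` gives equal Gram matrices for `(p I, z₁ G, z₂ H)` and `(Q, G, H)`, which is the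
identity on the bidisk. Both sides are Hermitian kernels holomorphic in `z`, so it extends to all
points. -/
theorem isDecomposition (𝒦 : KummertConstruction p Q) (h : IsLowestTerms S p Q) :
    IsDecomposition p Q 𝒦.G 𝒦.H := by
  intro w z
  refine sub_eq_zero.1 (kernel_eq_zero (D := fun w z => defect p Q w z -
    ((1 - conj w.1 * z.1) • gram 𝒦.G w z + (1 - conj w.2 * z.2) • gram 𝒦.H w z))
    (fun w z => ?_) (fun w i l => ?_) (fun w hw z hz => ?_) w z)
  · simp only [conjTranspose_sub, conjTranspose_add, conjTranspose_smul, conjTranspose_gram,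
      conjTranspose_defect, star_sub, star_one, star_mul', RCLike.star_def, Complex.conj_conj]
    rw [mul_comm w.1, mul_comm w.2]
  · have h1 := differentiable_gram 𝒦.G w i l
    have h2 := differentiable_gram 𝒦.H w i l
    have h3 := differentiable_defect p Q w i l
    simp only [Matrix.sub_apply, Matrix.add_apply, Matrix.smul_apply, smul_eq_mul]
    fun_prop
  · have h1 := congrArg₂ (fun X Y => Xᴴ * Y) (𝒦.V_mul h hw) (𝒦.V_mul h hz)
    simp only [conjTranspose_mul] at h1
    rw [Matrix.mul_assoc, ← Matrix.mul_assoc (𝒦.V)ᴴ, 𝒦.isometric, Matrix.one_mul,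
      conjTranspose_fromRows_mul_fromRows (fromRows (ev p w • _) _),
      conjTranspose_fromRows_mul_fromRows (fromRows (evM Q w) _),
      ← sub_eq_zero, add_sub_add_comm, gram_fromRows_sub, conjTranspose_smul, Matrix.smul_mul,
      Matrix.mul_smul, smul_smul, RCLike.star_def] at h1
    have hH : (evM 𝒦.H w)ᴴ * evM 𝒦.H z = gram 𝒦.H w z := rfl
    rw [hH] at h1
    rw [← h1, sub_smul _ _ (gram 𝒦.H w z), one_smul]
    abel

end KummertConstruction

end Bidisk

/-! ### The degree bound and dominance -/

namespace Bidisk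

variable {M N : ℕ}

/-- If `(1 - c X) q` has degree at most `n` and `c ≠ 0`, then `q` has degree less than `n`. -/
theorem coeff_eq_zero_of_one_sub_mul {c : ℂ} (hc : c ≠ 0) {q R : ℂ[X]} {n : ℕ}
    (hR : R.natDegree ≤ n) (h : (1 - C c * X) * q = R) {k : ℕ} (hk : n ≤ k) : q.coeff k = 0 := by
  have hstep : ∀ m, n ≤ m → q.coeff (m + 1) = c * q.coeff m := fun m hm => by
    have h1 := congrArg (fun q => q.coeff (m + 1)) h
    simp only [sub_mul, one_mul, mul_assoc, coeff_sub, coeff_C_mul, coeff_X_mul] at h1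
    rw [coeff_eq_zero_of_natDegree_lt (by omega : R.natDegree < m + 1)] at h1
    exact sub_eq_zero.1 h1
  -- From degree `n` on, the coefficients form a geometric sequence with nonzero ratio `c`; for a
  -- polynomial they must all be zero.
  have hpow : ∀ m, q.coeff (k + m) = c ^ m * q.coeff k := fun m => by
    induction m with
    | zero => simp
    | succ m ih => rw [← add_assoc, hstep _ (by omega), ih, pow_succ', mul_assoc]
  have h1 := hpow (q.natDegree + 1)
  rw [coeff_eq_zero_of_natDegree_lt (by omega : q.natDegree < k + (q.natDegree + 1)), eq_comm] at h1
  exact (mul_eq_zero.1 h1).resolve_left (pow_ne_zero _ hc)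

/-- The degree bound for one variable decompositions. -/
theorem coeff_eq_zero_of_defect {a c m : Type*} [Fintype a] [Fintype c] [Fintype m] {n : ℕ}
    (P : Matrix a m ℂ[X]) (Q : Matrix c m ℂ[X]) {g : Type*} [Fintype g] (Γ : Matrix g m ℂ[X])
    (hP : ∀ i j, (P i j).natDegree ≤ n) (hQ : ∀ i j, (Q i j).natDegree ≤ n)
    (h : ∀ w z : ℂ, (ev₁ P w)ᴴ * ev₁ P z - (ev₁ Q w)ᴴ * ev₁ Q z =
      (1 - conj w * z) • ((ev₁ Γ w)ᴴ * ev₁ Γ z)) (x : g) (j : m) {k : ℕ} (hk : n ≤ k) :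
    (Γ x j).coeff k = 0 := by
  have h1 : ∀ w : ℂ, w ≠ 0 → ∑ x, conj ((Γ x j).eval w) * (Γ x j).coeff k = 0 := fun w hw => by
    have h2 := coeff_eq_zero_of_one_sub_mul (c := conj w) (by simpa using hw) (n := n)
      (q := ∑ x, C (conj ((Γ x j).eval w)) * Γ x j)
      (R := ∑ i, C (conj ((P i j).eval w)) * P i j - ∑ i, C (conj ((Q i j).eval w)) * Q i j)
      ?_ ?_ hk
    · simpa only [finsetSum_coeff, coeff_C_mul] using h2
    · refine (natDegree_sub_le _ _).trans (max_le ?_ ?_)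
      · exact natDegree_sum_le_of_forall_le _ _ fun i _ => (natDegree_C_mul_le _ _).trans (hP i j)
      · exact natDegree_sum_le_of_forall_le _ _ fun i _ => (natDegree_C_mul_le _ _).trans (hQ i j)
    · refine Polynomial.funext fun z => ?_
      have h3 := congrFun (congrFun (h w z) j) j
      simp only [Matrix.sub_apply, Matrix.smul_apply, Matrix.mul_apply,
        Matrix.conjTranspose_apply, ev₁_apply, smul_eq_mul, RCLike.star_def] at h3
      simp only [eval_mul, eval_sub, eval_one, eval_C, eval_X, eval_finsetSum]
      exact h3.symm
  -- After conjugation the relation `h1` says that a polynomial in `w` vanishes on the circle. Its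
  -- coefficient of degree `k` is `∑ x, ‖(Γ x j).coeff k‖ ^ 2`.
  have h4 : ∑ x, C (conj ((Γ x j).coeff k)) * Γ x j = 0 := eq_of_eval_circle fun w hw => by
    have hw0 : w ≠ 0 := by rintro rfl; simp at hw
    have h5 := congrArg conj (h1 w hw0)
    simp only [map_sum, map_mul, Complex.conj_conj, map_zero] at h5
    simp only [eval_finsetSum, eval_mul, eval_C, eval_zero]
    rw [← h5]
    exact Finset.sum_congr rfl fun x _ => mul_comm _ _
  have h6 := congrArg (fun q => q.coeff k) h4
  simp only [finsetSum_coeff, coeff_C_mul, coeff_zero, Complex.conj_mul'] at h6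
  have h7 : ∑ x, ‖(Γ x j).coeff k‖ ^ 2 = 0 := by exact_mod_cast h6
  have h8 := (Finset.sum_eq_zero_iff_of_nonneg fun x _ => by positivity).1 h7 x (Finset.mem_univ x)
  simpa using h8

theorem natDegree_slice_le (f : BiPoly) (ζ : ℂ) : (slice f ζ).natDegree ≤ f.natDegree :=
  natDegree_map_le

/-- The first term of a decomposition has the form `C(z₂) Λ(z₁)`. -/
theorem IsDecomposition.exists_eq_timesLam {k l : ℕ} {p : BiPoly}
    {Q : Matrix (Fin M) (Fin N) BiPoly} {Γ₁ : Matrix (Fin k) (Fin N) BiPoly}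
    {Γ₂ : Matrix (Fin l) (Fin N) BiPoly} (h : IsDecomposition p Q Γ₁ Γ₂) :
    ∃ C : Matrix (Fin k) (Fin (degZ₁ p Q) × Fin N) ℂ[X], Γ₁ = timesLam C := by
  refine ⟨Matrix.of fun a x => (Γ₁ a x.2).coeff x.1, ?_⟩
  have hdeg : ∀ a j m, degZ₁ p Q ≤ m → (Γ₁ a j).coeff m = 0 := fun a j m hm =>
    eq_of_eval_circle fun ζ hζ => by
      have h1 := coeff_eq_zero_of_defect (n := degZ₁ p Q)
        ((p • (1 : Matrix (Fin N) (Fin N) BiPoly)).map fun f => slice f ζ)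
        (Q.map fun f => slice f ζ) (Γ₁.map fun f => slice f ζ) (fun i j => ?_) (fun i j => ?_)
        (fun w z => ?_) a j hm
      · simpa [slice] using h1
      · refine (natDegree_slice_le _ _).trans ?_
        by_cases hij : i = j
        · simpa [hij] using natDegree_le_degZ₁
        · simp [hij]
      · exact (natDegree_slice_le _ _).trans (natDegree_entry_le_degZ₁ i j)
      · rw [ev₁_slice, ev₁_slice, ev₁_slice, ev₁_slice, ev₁_slice, ev₁_slice, ← defect_eq_gram,
          h (w, ζ) (z, ζ), Complex.conj_mul', hζ]
        simp [gram]
  ext1 a j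
  ext1 m
  simp only [timesLam, Matrix.of_apply, finsetSum_coeff, coeff_C_mul, coeff_X_pow, mul_ite, mul_one,
    mul_zero]
  by_cases hm : m < degZ₁ p Q
  · rw [Finset.sum_eq_single (⟨m, hm⟩ : Fin _)]
    · simp
    · intro b _ hb
      rw [if_neg fun h => hb (Fin.ext h.symm)]
    · simp
  · rw [hdeg a j m (not_lt.1 hm)]
    exact (Finset.sum_eq_zero fun b _ => if_neg (by have := b.2; omega)).symm

/-- The dominance of the `z₁`-term of Kummert's construction. -/
theorem KummertConstruction.exists_kernel {p : BiPoly} {Q : Matrix (Fin M) (Fin N) BiPoly}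
    (𝒦 : KummertConstruction p Q) (h𝒦 : IsDecomposition p Q 𝒦.G 𝒦.H) {k l : ℕ}
    {Γ₁ : Matrix (Fin k) (Fin N) BiPoly} {Γ₂ : Matrix (Fin l) (Fin N) BiPoly}
    (h : IsDecomposition p Q Γ₁ Γ₂) :
    ∃ (s : ℕ) (Γ : Matrix (Fin s) (Fin N) BiPoly), ∀ w z : ℂ × ℂ,
      (1 - conj w.2 * z.2) • gram Γ w z = gram 𝒦.G w z - gram Γ₁ w z ∧
      (1 - conj w.1 * z.1) • gram Γ w z = gram Γ₂ w z - gram 𝒦.H w z := by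
  obtain ⟨C, rfl⟩ := h.exists_eq_timesLam
  -- At `w₂ = z₂ = ζ` on the circle the factor `1 - w̄₂ z₂` is zero, so `A* A` and `C* C` are the
  -- same coefficient matrix. Only `A` is known to have a right inverse in the disk, which fixes the
  -- sign of the difference.
  obtain ⟨s, L, hL⟩ := exists_gram_of_isometric 𝒦.A C (fun ζ hζ => by
    refine sub_eq_zero.1 (eq_zero_of_lam fun w z hw hz => ?_)
    have h1 := h (w, ζ) (z, ζ)
    rw [𝒦.factor ζ hζ, gram_timesLam, Complex.conj_mul', hζ] at h1
    simp only [Complex.ofReal_one, one_pow, sub_self, zero_smul, add_zero] at h1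
    rw [Matrix.mul_sub, Matrix.sub_mul, sub_eq_zero]
    exact smul_right_injective _ (one_sub_ne_zero hw hz) h1) 𝒦.exists_rightInverse_A
  have hfirst : ∀ w z : ℂ × ℂ, (1 - conj w.2 * z.2) • gram (timesLam L) w z =
      gram 𝒦.G w z - gram (timesLam C) w z := fun w z => by
    rw [G, gram_timesLam, gram_timesLam, gram_timesLam, ← Matrix.sub_mul, ← Matrix.mul_sub, hL,
      Matrix.mul_smul, Matrix.smul_mul]
  refine ⟨s, timesLam L, fun w z => ⟨hfirst w z, sub_eq_zero.1 (kernel_eq_zero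
    (D := fun w z => (1 - conj w.1 * z.1) • gram (timesLam L) w z -
      (gram Γ₂ w z - gram 𝒦.H w z)) (fun w z => ?_) (fun w i l => ?_) (fun w hw z hz => ?_) w z)⟩⟩
  · simp only [conjTranspose_sub, conjTranspose_smul, conjTranspose_gram, star_sub, star_one,
      star_mul', RCLike.star_def, Complex.conj_conj]
    rw [mul_comm w.1]
  · have h1 := differentiable_gram (timesLam L) w i l
    have h2 := differentiable_gram 𝒦.H w i l
    have h3 := differentiable_gram Γ₂ w i l
    simp only [Matrix.sub_apply, Matrix.smul_apply, smul_eq_mul]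
    fun_prop
  · refine sub_eq_zero.2 (smul_right_injective _ (one_sub_ne_zero hw.2 hz.2) ?_)
    have h1 := (h𝒦 w z).symm.trans (h w z)
    change (1 - conj w.2 * z.2) • (1 - conj w.1 * z.1) • gram (timesLam L) w z =
      (1 - conj w.2 * z.2) • (gram Γ₂ w z - gram 𝒦.H w z)
    rw [smul_comm, hfirst, smul_sub, smul_sub, sub_eq_sub_iff_add_eq_add, h1, add_comm]

end Bidisk

end

theorem proposition8p2 {M N : ℕ} (S : ℂ × ℂ → Matrix (Fin M) (Fin N) ℂ)
    (hS : Bidisk.IsRationalIsoInner S)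
    (p : Bidisk.BiPoly) (Q : Matrix (Fin M) (Fin N) Bidisk.BiPoly)
    (hpQ : Bidisk.IsLowestTerms S p Q) :
    Nonempty (Bidisk.KummertConstruction p Q) ∧
    ∀ 𝒦 : Bidisk.KummertConstruction p Q,
      Bidisk.IsDecomposition p Q 𝒦.G 𝒦.H ∧
      ∀ (k l : ℕ) (Γ₁ : Matrix (Fin k) (Fin N) Bidisk.BiPoly)
        (Γ₂ : Matrix (Fin l) (Fin N) Bidisk.BiPoly),
        Bidisk.IsDecomposition p Q Γ₁ Γ₂ →
        ∃ K : ℂ × ℂ → ℂ × ℂ → Matrix (Fin N) (Fin N) ℂ,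
          Bidisk.IsPolynomialKernel K ∧ Bidisk.IsPSDKernel K ∧
          ∀ w z : ℂ × ℂ,
            (1 - (starRingEnd ℂ) w.2 * z.2) • K w z =
              Bidisk.gram 𝒦.G w z - Bidisk.gram Γ₁ w z ∧
            (1 - (starRingEnd ℂ) w.1 * z.1) • K w z =
              Bidisk.gram Γ₂ w z - Bidisk.gram 𝒦.H w z := by
  refine ⟨Bidisk.nonempty_kummertConstruction hS hpQ, fun 𝒦 => ?_⟩
  have hdec := 𝒦.isDecomposition hpQ
  refine ⟨hdec, fun k l Γ₁ Γ₂ h => ?_⟩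
  obtain ⟨s, Γ, hΓ⟩ := 𝒦.exists_kernel hdec h
  exact ⟨Bidisk.gram Γ, Bidisk.isPolynomialKernel_gram Γ, Bidisk.isPSDKernel_gram Γ, hΓ⟩
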